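/- Let $\mathbb{T}$ be the one-dimensional torus of length $2\pi$, let $H^k(\mathbb{T})$ be the Sobolev spaces of complex-valued functions on $\mathbb{T}$, and write $\|u\|_2=\big(\int_0^{2\pi}|u|^2\,dx\big)^{1/2}$. Let $d,\zeta,f\in\mathbb{R}$ with $d\neq 0$, let $0\le\kappa<\frac{1}{\sqrt3}$, and put $\alpha_\kappa:=-2\kappa+\sqrt{1+\kappa^2}>0$. Assume that $\varphi\in H^4(\mathbb{T})$ satisfies $$2\pi\|\varphi_x\|_2+\max\{\sqrt{2\pi}\,|f|,\|\varphi\|_2\}<\sqrt{\frac{2\pi}{\alpha_\kappa}}.$$ Then the initial value problem $$i\,\partial_t a=-(i-\zeta)a-d\,a_{xx}-(1+i\kappa)|a|^2a+i f\quad\text{for } t\ge 0,\qquad a(0)=\varphi,$$ has a unique solution $a\in C([0,\infty);H^4(\mathbb{T}))$ (the time derivative being taken in $L^2(\mathbb{T})$, one-sided at $t=0$), and there is a constant $c\in\mathbb{C}$ such that $\|a(t)-c\|_{H^1(\mathbb{T})}\to0$ as $t\to\infty$. -/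

import Mathlib

open MeasureTheory Filter Topology Set
open scoped Real ContDiff

noncomputable section

/-- The one-dimensional torus of length `2π`. -/
abbrev Torus : Type := AddCircle (2 * π)

instance Torus.factTwoPiPos : Fact (0 < 2 * π) := ⟨Real.two_pi_pos⟩

/-- `L²(𝕋; ℂ)` for Lebesgue measure on the torus, of total mass `2π`, so that
`‖u‖² = ∫₀^{2π} |u|² dx`. -/
abbrev TorusL2 : Type := Lp ℂ 2 (volume : Measure Torus)

/-- `v` is the weak derivative of `u` on the torus: `∫ u ψ' = - ∫ v ψ` for every smooth test
function `ψ` on the torus with derivative `ψ'`. -/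
def IsWeakDeriv (u v : TorusL2) : Prop :=
  ∀ ψ ψ' : Torus → ℂ, ContDiff ℝ ∞ (fun x : ℝ => ψ (x : Torus)) →
    (∀ x : ℝ, HasDerivAt (fun y : ℝ => ψ (y : Torus)) (ψ' (x : Torus)) x) →
    ∫ x : Torus, u x * ψ' x = -∫ x : Torus, v x * ψ x

theorem Torus.continuous_of_lift {g : Torus → ℂ}
    (h : Continuous (fun x : ℝ => g (x : Torus))) : Continuous g :=
  continuous_coinduced_dom.2 h

theorem Torus.integrable_mul (u : TorusL2) {g : Torus → ℂ} (hg : Continuous g) :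
    Integrable (fun x => u x * g x) (volume : Measure Torus) := by
  have hu : Integrable (fun x => u x) (volume : Measure Torus) :=
    (Lp.memLp u).integrable (by norm_num)
  obtain ⟨C, hC⟩ := isCompact_univ.exists_bound_of_continuousOn (hg.continuousOn (s := univ))
  exact hu.mul_bdd hg.aestronglyMeasurable (Eventually.of_forall fun x => hC x (mem_univ x))

theorem Torus.continuous_test {ψ ψ' : Torus → ℂ}
    (h : ContDiff ℝ ∞ (fun x : ℝ => ψ (x : Torus)))
    (h' : ∀ x : ℝ, HasDerivAt (fun y : ℝ => ψ (y : Torus)) (ψ' (x : Torus)) x) :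
    Continuous ψ ∧ Continuous ψ' := by
  refine ⟨Torus.continuous_of_lift h.continuous, Torus.continuous_of_lift ?_⟩
  have e : (fun x : ℝ => ψ' (x : Torus)) = deriv (fun y : ℝ => ψ (y : Torus)) :=
    funext fun x => (h' x).deriv.symm
  rw [e]
  exact h.continuous_deriv (by simp)

theorem IsWeakDeriv.zero : IsWeakDeriv 0 0 := by
  intro ψ ψ' _ _
  have key : ∀ g : Torus → ℂ, ∫ x : Torus, (0 : TorusL2) x * g x = 0 := by
    intro g
    exact integral_eq_zero_of_ae <| Eventually.of_forall fun x => by simp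
  rw [key, key, neg_zero]

theorem IsWeakDeriv.add {u v u' v' : TorusL2} (h : IsWeakDeriv u v) (h' : IsWeakDeriv u' v') :
    IsWeakDeriv (u + u') (v + v') := by
  intro ψ ψ' hs hd
  obtain ⟨c, c'⟩ := Torus.continuous_test hs hd
  have key : ∀ (a b : TorusL2) (g : Torus → ℂ), Continuous g →
      ∫ x : Torus, (a + b : TorusL2) x * g x
        = (∫ x : Torus, a x * g x) + ∫ x : Torus, b x * g x := by
    intro a b g hg
    rw [← integral_add (Torus.integrable_mul a hg) (Torus.integrable_mul b hg)]
    refine integral_congr_ae ?_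
    filter_upwards [Lp.coeFn_add a b] with x hx
    simp only [hx, Pi.add_apply, add_mul]
  rw [key _ _ _ c', key _ _ _ c, h ψ ψ' hs hd, h' ψ ψ' hs hd, neg_add]

theorem IsWeakDeriv.smul {u v : TorusL2} (z : ℂ) (h : IsWeakDeriv u v) :
    IsWeakDeriv (z • u) (z • v) := by
  intro ψ ψ' hs hd
  have key : ∀ (a : TorusL2) (g : Torus → ℂ),
      ∫ x : Torus, (z • a : TorusL2) x * g x = z * ∫ x : Torus, a x * g x := by
    intro a g
    rw [← integral_const_mul]
    refine integral_congr_ae ?_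
    filter_upwards [Lp.coeFn_smul z a] with x hx
    simp only [hx, Pi.smul_apply, smul_eq_mul, mul_assoc]
  rw [key, key, h ψ ψ' hs hd, mul_neg]

/-- The Sobolev space `H^k(𝕋; ℂ)`. A function `u ∈ H^k` is represented by the tuple
`(u, ∂ₓu, …, ∂ₓᵏu)` of its weak derivatives in `L²` (which are determined by `u`), with the norm
`‖u‖² = ∑_{j ≤ k} ‖∂ₓʲu‖²_{L²}` inherited from the product. -/
def TorusSobolev (k : ℕ) : Submodule ℂ (PiLp 2 (fun _ : Fin (k + 1) => TorusL2)) where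
  carrier := {u | ∀ j : Fin k, IsWeakDeriv (u j.castSucc) (u j.succ)}
  zero_mem' := fun _ => IsWeakDeriv.zero
  add_mem' := fun hu hv j => (hu j).add (hv j)
  smul_mem' := fun z _ hu j => (hu j).smul z

/-- The weak derivative `∂ₓʲu ∈ L²` of `u ∈ H^k`, for `j ≤ k`. -/
def TorusSobolev.D {k : ℕ} (j : Fin (k + 1)) (u : TorusSobolev k) : TorusL2 := u.1 j

/-- The inclusion `H^k ⊆ H^l` for `l ≤ k`. -/
def TorusSobolev.incl {k l : ℕ} (h : l ≤ k) (u : TorusSobolev k) : TorusSobolev l :=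
  ⟨WithLp.toLp 2 fun j => u.1 (Fin.castLE (Nat.succ_le_succ h) j),
    fun j => u.2 (Fin.castLE h j)⟩

theorem IsWeakDeriv.const (c : ℂ) : IsWeakDeriv (Lp.const 2 volume c) 0 := by
  intro ψ ψ' hs hd
  obtain ⟨_, c'⟩ := Torus.continuous_test hs hd
  have e1 : ∫ x : Torus, (Lp.const 2 volume c : TorusL2) x * ψ' x = c * ∫ x : Torus, ψ' x := by
    rw [← integral_const_mul]
    exact integral_congr_ae <| Eventually.of_forall fun x => by simp
  have e2 : ∫ x : Torus, (0 : TorusL2) x * ψ x = 0 := by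
    exact integral_eq_zero_of_ae <| Eventually.of_forall fun x => by simp
  have e3 : ∫ x : Torus, ψ' x = 0 := by
    rw [← AddCircle.intervalIntegral_preimage (2 * π) 0 ψ',
      intervalIntegral.integral_eq_sub_of_hasDerivAt (fun x _ => hd x)
        ((c'.comp (AddCircle.continuous_mk' _)).intervalIntegrable _ _)]
    rw [AddCircle.coe_add_period, sub_self]
  rw [e1, e2, e3, mul_zero, neg_zero]

/-- The constant function `c` as an element of `H¹(𝕋; ℂ)`. -/
def TorusSobolev.const (c : ℂ) : TorusSobolev 1 :=
  ⟨WithLp.toLp 2 ![Lp.const 2 volume c, 0], fun j => by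
    fin_cases j
    exact IsWeakDeriv.const c⟩

/-- `a ∈ C([0,∞); H⁴(𝕋))` solves the Lugiato-Lefever equation with two-photon absorption
`i ∂ₜa = -(i - ζ) a - d ∂ₓₓa - (1 + iκ)|a|²a + i f` for all times `t ≥ 0`: the time derivative `∂ₜa`
exists in `L²(𝕋)` (one-sided at `t = 0`), and the equation holds almost everywhere on `𝕋`. Only the
values `a t` with `t ≥ 0` are relevant. -/
structure IsLLESolution (d ζ f κ : ℝ) (a : ℝ → TorusSobolev 4) : Prop where
  continuousOn : ContinuousOn a (Ici 0)
  equation : ∀ t : ℝ, 0 ≤ t → ∃ a_t : TorusL2,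
    HasDerivWithinAt (fun s => TorusSobolev.D 0 (a s)) a_t (Ici 0) t ∧
    ∀ᵐ x : Torus, Complex.I * a_t x =
      -(Complex.I - ζ) * TorusSobolev.D 0 (a t) x - d * TorusSobolev.D 2 (a t) x
        - (1 + Complex.I * κ) * ‖TorusSobolev.D 0 (a t) x‖ ^ 2 * TorusSobolev.D 0 (a t) x
        + Complex.I * f

/-- The constant `α_κ = -2κ + √(1 + κ²)`. -/
def alphaLLE (κ : ℝ) : ℝ := -2 * κ + √(1 + κ ^ 2)

end

/-!
The equation, multiplied by `-i`, reads `∂ₜa = -(1 + iζ)a + i d ∂ₓₓa + (i - κ)|a|²a + f`.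

Everything rests on one pointwise inequality: the linearisation of `(i - κ)|a|²a` at `a` satisfies
`Re ⟨p, (i - κ)(2|a|²p + a² p̄)⟩ ≤ α_κ |a|² |p|²` (`re_linearized_cube_le`, and
`re_cube_sub_cube_le` for differences). Since the Schrödinger term is skew-adjoint and the damping
has rate `1`, it follows that while `α_κ ‖a‖_∞² ≤ q`

* `‖∂ₓa‖₂` is bounded by a multiple of `e^{-(1 - q)t}` (`norm_D_one_sq_le`), and
* two solutions approach each other in `L²` at that rate (`norm_D_zero_sub_sq_le`).

For `q` large the second fact is uniqueness. The `L²` energy inequality keeps `‖a‖₂` below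
`max (√(2π)|f|, ‖φ‖₂)`, and `√(2π)‖a‖_∞ ≤ ‖a‖₂ + 2π‖∂ₓa‖₂`; so by a continuity argument the
smallness condition on `φ` persists with some `q < 1` (`IsSolutionOn.wiener_le`). Then `∂ₓa → 0`,
and applying the contraction to `a` and its time translates shows that the mean of `a` converges
(`exists_tendsto`).

Existence is proved in Fourier variables. A function `u ∈ H⁴` is encoded by the `ℓ²` sequence of the
Fourier coefficients of `(1 + ∂ₓ⁴)u`. In the interaction picture `b(t) = e^{-i t d ∂ₓₓ}a(t)` the
equation, with its nonlinearity precomposed with the radial retraction onto a ball, is an ordinary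
differential equation with a bounded and globally Lipschitz right-hand side, which the
Picard–Lindelöf theorem solves on any interval (`exists_truncated`). By the tame estimate
`‖|u|²u‖_{H⁴} ≲ (∑ |ûₙ|)² ‖u‖_{H⁴}` (`norm_cube_le`) the solution does not leave a sufficiently
large ball on `[0, T]` (`exists_solution`), so that the truncation is not felt.
-/

noncomputable section

/-! ### The Fourier transform on `L²(𝕋)` -/

/-- The sequence space `ℓ²(ℤ; ℂ)`, in which Fourier coefficients live. -/
abbrev EllTwo : Type := lp (fun _ : ℤ => ℂ) 2

namespace Torus

/-- A continuous function on the torus as an element of `L²(𝕋)`. -/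
def toL2 : C(Torus, ℂ) →L[ℂ] TorusL2 := ContinuousMap.toLp 2 volume ℂ

theorem coeFn_toL2 (U : C(Torus, ℂ)) : toL2 U =ᵐ[volume] U :=
  ContinuousMap.coeFn_toLp (𝕜 := ℂ) (p := 2) volume U

theorem inner_L2 (u v : TorusL2) : inner ℂ u v = ∫ x : Torus, star (u x) * v x := by
  rw [L2.inner_def]
  exact integral_congr_ae <| Eventually.of_forall fun x => by
    simp [RCLike.inner_apply, mul_comm]

theorem inner_toL2_left (U : C(Torus, ℂ)) (v : TorusL2) :
    inner ℂ (toL2 U) v = ∫ x : Torus, star (U x) * v x := by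
  rw [inner_L2]
  refine integral_congr_ae ?_
  filter_upwards [coeFn_toL2 U] with x hx
  rw [hx]

theorem inner_toL2 (U V : C(Torus, ℂ)) :
    inner ℂ (toL2 U) (toL2 V) = ∫ x : Torus, star (U x) * V x := by
  rw [inner_toL2_left]
  refine integral_congr_ae ?_
  filter_upwards [coeFn_toL2 V] with x hx
  rw [hx]

theorem inner_toL2_fourier (m n : ℤ) :
    inner ℂ (toL2 (fourier m)) (toL2 (fourier n)) = if m = n then (2 * π : ℂ) else 0 := by
  have h := congrFun (fourierCoeff_fourier (T := 2 * π) n) m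
  rw [fourierCoeff, AddCircle.integral_haarAddCircle] at h
  rw [inner_toL2]
  have e : ∀ x : Torus, star (fourier m x) * fourier n x = fourier (-m) x • fourier n x := by
    intro x; simp
  simp_rw [e]
  have hpi : ((2 * π : ℝ) : ℂ) ≠ 0 := by exact_mod_cast Real.two_pi_pos.ne'
  rw [Pi.single_apply, Complex.real_smul, Complex.ofReal_inv] at h
  rw [inv_mul_eq_iff_eq_mul₀ hpi] at h
  rw [h]; split_ifs <;> simp

/-- The normalising constant `√(2π)`, as a complex number. -/
def sqrtTwoPi : ℂ := ((√(2 * π) : ℝ) : ℂ)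

theorem sqrtTwoPi_ne_zero : sqrtTwoPi ≠ 0 := by
  have : 0 < √(2 * π) := Real.sqrt_pos.2 Real.two_pi_pos
  simpa [sqrtTwoPi] using this.ne'

theorem sqrtTwoPi_mul_self : sqrtTwoPi * sqrtTwoPi = 2 * π := by
  rw [sqrtTwoPi, ← Complex.ofReal_mul, Real.mul_self_sqrt Real.two_pi_pos.le]; simp

theorem norm_sqrtTwoPi : ‖sqrtTwoPi‖ = √(2 * π) := by
  rw [sqrtTwoPi, Complex.norm_real, Real.norm_of_nonneg (Real.sqrt_nonneg _)]

theorem conj_sqrtTwoPi : (starRingEnd ℂ) sqrtTwoPi = sqrtTwoPi := Complex.conj_ofReal _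

theorem orthonormal_basis :
    Orthonormal ℂ (fun n : ℤ => sqrtTwoPi⁻¹ • toL2 (fourier n)) := by
  rw [orthonormal_iff_ite]
  intro m n
  rw [inner_smul_left, inner_smul_right, inner_toL2_fourier, map_inv₀, conj_sqrtTwoPi]
  have := sqrtTwoPi_ne_zero
  split_ifs
  · rw [← sqrtTwoPi_mul_self]; field_simp
  · simp

theorem span_basis :
    ⊤ ≤ (Submodule.span ℂ
      (range fun n : ℤ => sqrtTwoPi⁻¹ • toL2 (fourier n))).topologicalClosure := by
  have h1 : (Submodule.span ℂ (range fun n : ℤ => toL2 (fourier n))).topologicalClosure = ⊤ := by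
    convert! (ContinuousMap.toLp_denseRange ℂ (volume : Measure Torus) ℂ
      (p := 2) (by norm_num)).topologicalClosure_map_submodule span_fourier_closure_eq_top
    rw [Submodule.map_span]
    rw [show (fun n : ℤ => toL2 (fourier n)) = toL2 ∘ fourier from rfl, range_comp]
    rfl
  rw [← h1]
  refine Submodule.topologicalClosure_mono (Submodule.span_le.2 ?_)
  rintro _ ⟨n, rfl⟩
  have : toL2 (fourier n) = sqrtTwoPi • (sqrtTwoPi⁻¹ • toL2 (fourier n)) := by
    rw [smul_inv_smul₀ sqrtTwoPi_ne_zero]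
  simp only [SetLike.mem_coe]
  rw [this]
  exact Submodule.smul_mem _ _ (Submodule.subset_span ⟨n, rfl⟩)

/-- The orthonormal basis `e^{inx} / √(2π)` of `L²(𝕋)`. -/
def basis : HilbertBasis ℤ ℂ TorusL2 := HilbertBasis.mk orthonormal_basis span_basis

/-- The Fourier transform `u ↦ ((2π)⁻¹ ∫ u e^{-inx})ₙ`, as an isomorphism `L²(𝕋) ≃ ℓ²(ℤ)`; it is
`(2π)^{-1/2}` times an isometry. -/
def fourierL2 : TorusL2 ≃L[ℂ] EllTwo :=
  basis.repr.toContinuousLinearEquiv.trans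
    (ContinuousLinearEquiv.smulLeft (Units.mk0 sqrtTwoPi⁻¹ (inv_ne_zero sqrtTwoPi_ne_zero)))

theorem fourierL2_eq_smul (u : TorusL2) : fourierL2 u = sqrtTwoPi⁻¹ • basis.repr u := rfl

theorem fourierL2_apply (u : TorusL2) (n : ℤ) :
    fourierL2 u n = (2 * π : ℂ)⁻¹ * inner ℂ (toL2 (fourier n)) u := by
  rw [fourierL2_eq_smul, lp.coeFn_smul, Pi.smul_apply, HilbertBasis.repr_apply_apply, basis,
    HilbertBasis.coe_mk, inner_smul_left, map_inv₀, conj_sqrtTwoPi, smul_eq_mul, ← mul_assoc,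
    ← mul_inv, sqrtTwoPi_mul_self]

theorem inner_fourierL2 (u v : TorusL2) :
    inner ℂ u v = 2 * π * inner ℂ (fourierL2 u) (fourierL2 v) := by
  rw [fourierL2_eq_smul, fourierL2_eq_smul, inner_smul_left, inner_smul_right,
    LinearIsometryEquiv.inner_map_map, map_inv₀, conj_sqrtTwoPi, ← sqrtTwoPi_mul_self]
  have := sqrtTwoPi_ne_zero
  field_simp

theorem norm_eq_mul_norm_fourierL2 (u : TorusL2) : ‖u‖ = √(2 * π) * ‖fourierL2 u‖ := by
  rw [fourierL2_eq_smul, norm_smul, norm_inv, norm_sqrtTwoPi, LinearIsometryEquiv.norm_map,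
    mul_inv_cancel_left₀]
  exact (Real.sqrt_pos.2 Real.two_pi_pos).ne'

theorem fourierL2_toL2_fourier (n : ℤ) :
    fourierL2 (toL2 (fourier n)) = lp.single 2 n (1 : ℂ) := by
  ext m
  have hpi : (2 * π : ℂ) ≠ 0 := by exact_mod_cast Real.two_pi_pos.ne'
  rw [fourierL2_apply, inner_toL2_fourier, lp.single_apply, Pi.single_apply]
  split_ifs
  · exact inv_mul_cancel₀ hpi
  · simp

/-! ### Weak derivatives in terms of Fourier coefficients -/

theorem hasDerivAt_fourier_two_pi (n : ℤ) (x : ℝ) :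
    HasDerivAt (fun y : ℝ => (fourier n (y : Torus) : ℂ))
      (Complex.I * n * fourier n (x : Torus)) x := by
  convert! hasDerivAt_fourier (2 * π) n x using 1
  have : (π : ℂ) ≠ 0 := by exact_mod_cast Real.pi_ne_zero
  push_cast; field_simp

theorem contDiff_fourier (n : ℤ) :
    ContDiff ℝ ∞ (fun y : ℝ => (fourier n (y : Torus) : ℂ)) := by
  simp_rw [fourier_coe_apply]
  have : ContDiff ℝ ∞ (fun y : ℝ => (y : ℂ)) := Complex.ofRealCLM.contDiff
  fun_prop

theorem integral_eq_zero_of_hasDerivAt {g g' : Torus → ℂ} (hc : Continuous g')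
    (hd : ∀ x : ℝ, HasDerivAt (fun y : ℝ => g (y : Torus)) (g' (x : Torus)) x) :
    ∫ x : Torus, g' x = 0 := by
  rw [← AddCircle.intervalIntegral_preimage (2 * π) 0 g',
    intervalIntegral.integral_eq_sub_of_hasDerivAt (fun x _ => hd x)
      ((hc.comp (AddCircle.continuous_mk' _)).intervalIntegrable _ _)]
  rw [AddCircle.coe_add_period, sub_self]

theorem fourierL2_of_hasDerivAt {ψ ψ' : C(Torus, ℂ)}
    (hd : ∀ x : ℝ, HasDerivAt (fun y : ℝ => ψ (y : Torus)) (ψ' (x : Torus)) x) (n : ℤ) :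
    fourierL2 (toL2 ψ') n = Complex.I * n * fourierL2 (toL2 ψ) n := by
  have h := integral_eq_zero_of_hasDerivAt (g := fun x => fourier (-n) x * ψ x)
    (g' := fun x => Complex.I * (-n : ℤ) * fourier (-n) x * ψ x + fourier (-n) x * ψ' x)
    (by fun_prop) (fun x => (hasDerivAt_fourier_two_pi (-n) x).mul (hd x))
  have hi : ∀ f : Torus → ℂ, Continuous f → Integrable f (volume : Measure Torus) := fun f hf =>
    hf.integrable_of_hasCompactSupport (HasCompactSupport.of_compactSpace f)
  rw [integral_add (hi _ (by fun_prop)) (hi _ (by fun_prop))] at h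
  rw [fourierL2_apply, fourierL2_apply, inner_toL2, inner_toL2]
  have e : ∀ V : C(Torus, ℂ), ∫ x : Torus, star (fourier n x) * V x
      = ∫ x : Torus, fourier (-n) x * V x := fun V => by simp
  rw [e, e]
  simp_rw [mul_assoc] at h
  rw [integral_const_mul, integral_const_mul] at h
  push_cast at h
  linear_combination (2 * π : ℂ)⁻¹ * h

theorem isWeakDeriv_iff (u v : TorusL2) :
    IsWeakDeriv u v ↔ ∀ n : ℤ, fourierL2 v n = Complex.I * n * fourierL2 u n := by
  constructor
  · intro h n
    have h1 := h (fun x => fourier (-n) x) (fun x => Complex.I * (-n : ℤ) * fourier (-n) x)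
      (contDiff_fourier (-n)) (hasDerivAt_fourier_two_pi (-n))
    rw [fourierL2_apply, fourierL2_apply, inner_toL2_left, inner_toL2_left]
    have e : ∀ w : TorusL2, ∫ x : Torus, star (fourier n x) * w x
      = ∫ x : Torus, w x * fourier (-n) x := fun w => by simp [mul_comm]
    rw [e, e]
    have e2 : ∫ x : Torus, u x * (Complex.I * (-n : ℤ) * fourier (-n) x)
        = Complex.I * (-n : ℤ) * ∫ x : Torus, u x * fourier (-n) x := by
      rw [← integral_const_mul]; congr 1; ext x; ring
    rw [e2] at h1
    push_cast at h1
    linear_combination (2 * π : ℂ)⁻¹ * h1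
  · intro h ψ ψ' hs hd
    obtain ⟨c, c'⟩ := Torus.continuous_test hs hd
    let Ψ : C(Torus, ℂ) := ⟨fun x => star (ψ x), c.star⟩
    let Ψ' : C(Torus, ℂ) := ⟨fun x => star (ψ' x), c'.star⟩
    have hΨ : ∀ n, fourierL2 (toL2 Ψ') n = Complex.I * n * fourierL2 (toL2 Ψ) n :=
      fourierL2_of_hasDerivAt fun x => (hd x).star
    have e : ∀ (w : TorusL2) (χ : C(Torus, ℂ)), ∫ x : Torus, w x * star (χ x)
        = 2 * π * ∑' n : ℤ, inner ℂ (fourierL2 (toL2 χ) n) (fourierL2 w n) := by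
      intro w χ
      rw [← lp.inner_eq_tsum, ← inner_fourierL2, inner_toL2_left]
      simp_rw [mul_comm]
    have e1 := e u Ψ'
    have e2 := e v Ψ
    simp only [Ψ, Ψ', ContinuousMap.coe_mk, star_star] at e1 e2
    rw [e1, e2, ← mul_neg, ← tsum_neg]
    congr 1
    refine tsum_congr fun n => ?_
    have := hΨ n
    simp only [Ψ, Ψ'] at this
    rw [h n, this]
    simp only [RCLike.inner_apply, map_mul, Complex.conj_I, map_intCast]
    ring

end Torus

/-! ### Functions in `H⁴` as sequences in `ℓ²` -/

namespace EllTwo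

theorem two_toReal_pos : 0 < (2 : ENNReal).toReal := by norm_num

theorem norm_sq_eq_tsum (v : EllTwo) : ‖v‖ ^ 2 = ∑' n : ℤ, ‖v n‖ ^ 2 := by
  have := lp.norm_rpow_eq_tsum two_toReal_pos v
  simpa using this

theorem summable_norm_sq (v : EllTwo) : Summable fun n : ℤ => ‖v n‖ ^ 2 := by
  have := (lp.memℓp v).summable two_toReal_pos
  simpa using this

theorem norm_apply_le (v : EllTwo) (n : ℤ) : ‖v n‖ ≤ ‖v‖ :=
  lp.norm_apply_le_norm (by norm_num) v n

/-- Multiplication of a square-summable sequence by a symbol bounded by `1`. -/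
def mult (m : ℤ → ℂ) (hm : ∀ n, ‖m n‖ ≤ 1) : EllTwo →L[ℂ] EllTwo :=
  LinearMap.mkContinuous
    { toFun := fun v => ⟨fun n => m n * v n, (lp.memℓp v).mono' fun n => by
        rw [norm_mul]; exact mul_le_of_le_one_left (norm_nonneg _) (hm n)⟩
      map_add' := fun v w => by ext n; exact mul_add _ _ _
      map_smul' := fun c v => by ext n; exact mul_left_comm _ _ _ } 1 fun v => by
    rw [one_mul]
    refine lp.norm_mono (by norm_num) fun n => ?_
    change ‖m n * v n‖ ≤ _
    rw [norm_mul]; exact mul_le_of_le_one_left (norm_nonneg _) (hm n)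

theorem mult_apply (m : ℤ → ℂ) (hm : ∀ n, ‖m n‖ ≤ 1) (v : EllTwo) (n : ℤ) :
    mult m hm v n = m n * v n := rfl

theorem norm_mult_le (m : ℤ → ℂ) (hm : ∀ n, ‖m n‖ ≤ 1) (v : EllTwo) : ‖mult m hm v‖ ≤ ‖v‖ := by
  refine lp.norm_mono (by norm_num) fun n => ?_
  rw [mult_apply, norm_mul]; exact mul_le_of_le_one_left (norm_nonneg _) (hm n)

/-- The weight `1 + n⁴` of `H⁴`. It is the symbol of `1 + ∂ₓ⁴`. -/
def wt (n : ℤ) : ℝ := 1 + (n : ℝ) ^ 4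

theorem wt_pos (n : ℤ) : 0 < wt n := by unfold wt; positivity

theorem wt_ne_zero (n : ℤ) : (wt n : ℂ) ≠ 0 := by exact_mod_cast (wt_pos n).ne'

/-- The symbol `(in)ʲ / (1 + n⁴)`. -/
def symb (j : Fin 5) (n : ℤ) : ℂ := (Complex.I * n) ^ (j : ℕ) / wt n

theorem abs_pow_le_wt (j : Fin 5) (n : ℤ) : |(n : ℝ)| ^ (j : ℕ) ≤ wt n := by
  have h4 : (n : ℝ) ^ 4 = |(n : ℝ)| ^ 4 := (Even.pow_abs (by decide) _).symm
  rw [wt, h4]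
  rcases le_total |(n : ℝ)| 1 with h | h
  · exact (pow_le_one₀ (abs_nonneg _) h).trans (le_add_of_nonneg_right (by positivity))
  · exact (pow_le_pow_right₀ h (by omega)).trans (le_add_of_nonneg_left zero_le_one)

theorem norm_symb_le (j : Fin 5) (n : ℤ) : ‖symb j n‖ ≤ 1 := by
  rw [symb, norm_div, norm_pow, norm_mul, Complex.norm_I, one_mul, Complex.norm_intCast,
    Complex.norm_real, Real.norm_of_nonneg (wt_pos n).le]
  exact div_le_one_of_le₀ (abs_pow_le_wt j n) (wt_pos n).le

/-- A sequence `v ∈ ℓ²` encodes the function `u ∈ H⁴` with `(1 + ∂ₓ⁴) u = ∑ vₙ e^{inx}`; `D j v` is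
the sequence of Fourier coefficients of `∂ₓʲ u`. -/
def D (j : Fin 5) : EllTwo →L[ℂ] EllTwo := mult (symb j) (norm_symb_le j)

theorem D_apply (j : Fin 5) (v : EllTwo) (n : ℤ) : D j v n = symb j n * v n := rfl

theorem norm_D_le (j : Fin 5) (v : EllTwo) : ‖D j v‖ ≤ ‖v‖ := norm_mult_le _ _ _

theorem symb_zero (n : ℤ) : symb 0 n = (wt n : ℂ)⁻¹ := by simp [symb]

theorem symb_eq (j : Fin 5) (n : ℤ) : symb j n = (Complex.I * n) ^ (j : ℕ) * symb 0 n := by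
  rw [symb_zero, symb, div_eq_mul_inv]

theorem D_apply_eq (j : Fin 5) (v : EllTwo) (n : ℤ) :
    D j v n = (Complex.I * n) ^ (j : ℕ) * D 0 v n := by
  rw [D_apply, D_apply, symb_eq, mul_assoc]

theorem D_one_apply (v : EllTwo) (n : ℤ) : D 1 v n = Complex.I * n * D 0 v n := by
  rw [D_apply_eq]; simp

theorem D_two_apply (v : EllTwo) (n : ℤ) : D 2 v n = -(n : ℂ) ^ 2 * D 0 v n := by
  rw [D_apply_eq]; simp [mul_pow]

theorem apply_eq_wt_mul (v : EllTwo) (n : ℤ) : v n = wt n * D 0 v n := by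
  rw [D_apply, symb_zero, mul_inv_cancel_left₀ (wt_ne_zero n)]

theorem D_zero_injective : Function.Injective (D 0) := by
  intro v w h
  ext n
  rw [apply_eq_wt_mul, apply_eq_wt_mul w, h]

theorem inner_D_zero_D_two (v w : EllTwo) :
    inner ℂ (D 0 v) (D 2 w) = -inner ℂ (D 1 v) (D 1 w) := by
  rw [lp.inner_eq_tsum, lp.inner_eq_tsum, ← tsum_neg]
  refine tsum_congr fun n => ?_
  rw [D_two_apply, D_one_apply, D_one_apply]
  simp only [RCLike.inner_apply, map_mul, Complex.conj_I, map_intCast]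
  linear_combination -(n : ℂ) ^ 2 * D 0 w n * (starRingEnd ℂ) (D 0 v n) * Complex.I_sq

theorem inner_D_two_D_zero (v w : EllTwo) :
    inner ℂ (D 2 v) (D 0 w) = -inner ℂ (D 1 v) (D 1 w) := by
  rw [← inner_conj_symm, inner_D_zero_D_two, map_neg, inner_conj_symm]

/-- The constant function `1` has a single Fourier coefficient, and it is fixed by `1 + ∂ₓ⁴`. -/
def one : EllTwo := lp.single 2 0 (1 : ℂ)

theorem one_apply (n : ℤ) : one n = if n = 0 then 1 else 0 := by
  rw [one, lp.single_apply, Pi.single_apply]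

theorem D_zero_one : D 0 one = one := by
  ext n
  rw [D_apply, one_apply, symb_zero]
  split_ifs with h
  · subst h; simp [wt]
  · simp

end EllTwo

namespace TorusSobolev

open EllTwo Torus

/-- The element of `H⁴(𝕋)` encoded by a sequence `v ∈ ℓ²`. -/
def ofEllTwo (v : EllTwo) : TorusSobolev 4 :=
  ⟨WithLp.toLp 2 fun j => fourierL2.symm (EllTwo.D j v), fun j => by
    rw [isWeakDeriv_iff]
    intro n
    simp only [ContinuousLinearEquiv.apply_symm_apply]
    rw [D_apply_eq, D_apply_eq j.castSucc]
    simp [pow_succ]; ring⟩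

theorem continuous_ofEllTwo : Continuous ofEllTwo := by
  refine Continuous.subtype_mk ?_ _
  refine (PiLp.continuous_toLp 2 _).comp ?_
  fun_prop

theorem D_ofEllTwo (j : Fin 5) (v : EllTwo) :
    TorusSobolev.D j (ofEllTwo v) = fourierL2.symm (EllTwo.D j v) := rfl

theorem fourierL2_D_ofEllTwo (j : Fin 5) (v : EllTwo) :
    fourierL2 (TorusSobolev.D j (ofEllTwo v)) = EllTwo.D j v := by
  rw [D_ofEllTwo, ContinuousLinearEquiv.apply_symm_apply]

/-- The sequence encoding `u ∈ H⁴(𝕋)`: the Fourier coefficients of `u + ∂ₓ⁴u`. -/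
def toEllTwo (u : TorusSobolev 4) : EllTwo :=
  fourierL2 (TorusSobolev.D 0 u + TorusSobolev.D 4 u)

theorem continuous_D {k : ℕ} (j : Fin (k + 1)) :
    Continuous (TorusSobolev.D j : TorusSobolev k → TorusL2) :=
  (PiLp.continuous_apply 2 _ j).comp continuous_subtype_val

theorem continuous_toEllTwo : Continuous toEllTwo :=
  fourierL2.continuous.comp ((continuous_D 0).add (continuous_D 4))

theorem fourierL2_D (u : TorusSobolev 4) (j : Fin 5) (n : ℤ) :
    fourierL2 (TorusSobolev.D j u) n
      = (Complex.I * n) ^ (j : ℕ) * fourierL2 (TorusSobolev.D 0 u) n := by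
  induction j using Fin.induction with
  | zero => simp
  | succ j ih =>
    rw [TorusSobolev.D, (isWeakDeriv_iff _ _).1 (u.2 j) n]
    rw [TorusSobolev.D] at ih
    rw [ih, Fin.val_succ, pow_succ, Fin.val_castSucc]; ring

theorem toEllTwo_apply (u : TorusSobolev 4) (n : ℤ) :
    toEllTwo u n = wt n * fourierL2 (TorusSobolev.D 0 u) n := by
  rw [toEllTwo, map_add, lp.coeFn_add, Pi.add_apply, fourierL2_D u 4]
  have : ((4 : Fin 5) : ℕ) = 4 := rfl
  rw [this, mul_pow, Complex.I_pow_four, wt]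
  push_cast; ring

theorem D_toEllTwo (j : Fin 5) (u : TorusSobolev 4) :
    EllTwo.D j (toEllTwo u) = fourierL2 (TorusSobolev.D j u) := by
  ext n
  rw [EllTwo.D_apply, symb_eq, symb_zero, toEllTwo_apply, fourierL2_D u j, ← mul_assoc,
    inv_mul_cancel_right₀ (wt_ne_zero n)]

theorem ofEllTwo_toEllTwo (u : TorusSobolev 4) : ofEllTwo (toEllTwo u) = u := by
  apply Subtype.ext
  ext1 j
  change TorusSobolev.D j (ofEllTwo (toEllTwo u)) = TorusSobolev.D j u
  rw [D_ofEllTwo, D_toEllTwo, ContinuousLinearEquiv.symm_apply_apply]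

theorem toEllTwo_ofEllTwo (v : EllTwo) : toEllTwo (ofEllTwo v) = v := by
  apply D_zero_injective
  rw [D_toEllTwo, fourierL2_D_ofEllTwo]

end TorusSobolev

namespace Torus

/-! ### Absolutely convergent Fourier series -/

/-- The continuous function with Fourier coefficients `f`, for absolutely summable `f`. -/
def series (f : ℤ → ℂ) : C(Torus, ℂ) := ∑' n : ℤ, f n • fourier n

theorem norm_smul_fourier (c : ℂ) (n : ℤ) : ‖c • (fourier n : C(Torus, ℂ))‖ = ‖c‖ := by
  rw [norm_smul, fourier_norm, mul_one]

theorem hasSum_series {f : ℤ → ℂ} (hf : Summable fun n => ‖f n‖) :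
    HasSum (fun n => f n • (fourier n : C(Torus, ℂ))) (series f) := by
  refine (Summable.of_norm ?_).hasSum
  simpa only [norm_smul_fourier] using hf

theorem norm_series_le {f : ℤ → ℂ} (hf : Summable fun n => ‖f n‖) :
    ‖series f‖ ≤ ∑' n, ‖f n‖ := by
  have h : Summable fun n => ‖f n • (fourier n : C(Torus, ℂ))‖ := by
    simpa only [norm_smul_fourier] using hf
  exact (norm_tsum_le_tsum_norm h).trans_eq (tsum_congr fun n => norm_smul_fourier _ _)

theorem series_add {f g : ℤ → ℂ} (hf : Summable fun n => ‖f n‖) (hg : Summable fun n => ‖g n‖) :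
    series (f + g) = series f + series g := by
  rw [series, ← ((hasSum_series hf).add (hasSum_series hg)).tsum_eq]
  simp only [Pi.add_apply, add_smul]

theorem star_series {f : ℤ → ℂ} (hf : Summable fun n => ‖f n‖) :
    star (series f) = series fun n => star (f (-n)) := by
  have h := (hasSum_series hf).star
  rw [← (Equiv.neg ℤ).hasSum_iff] at h
  refine h.tsum_eq.symm.trans (tsum_congr fun n => ?_)
  ext x
  simp

theorem fourierL2_toL2_series (F : EllTwo) (hF : Summable fun n => ‖F n‖) :
    fourierL2 (toL2 (series F)) = F := by
  have h := ((hasSum_series hF).mapL toL2).mapL (fourierL2 : TorusL2 →L[ℂ] EllTwo)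
  have h2 := lp.hasSum_single (p := 2) (by norm_num) F
  refine (h.unique ?_)
  convert! h2 using 1
  ext1 n
  simp only [ContinuousLinearEquiv.coe_coe, map_smul, fourierL2_toL2_fourier]
  rw [← lp.single_smul, smul_eq_mul, mul_one]

/-- Convolution of sequences indexed by `ℤ`. -/
def conv (f g : ℤ → ℂ) (n : ℤ) : ℂ := ∑' k : ℤ, f k * g (n - k)

/-- The bijection `(n, k) ↦ (k, n - k)` of `ℤ × ℤ`. -/
def convEquiv : ℤ × ℤ ≃ ℤ × ℤ where
  toFun z := (z.2, z.1 - z.2)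
  invFun z := (z.1 + z.2, z.1)
  left_inv z := by simp
  right_inv z := by simp

theorem summable_conv_prod {f g : ℤ → ℂ} (hf : Summable fun n => ‖f n‖)
    (hg : Summable fun n => ‖g n‖) :
    Summable fun z : ℤ × ℤ => ‖f z.2 * g (z.1 - z.2)‖ := by
  have := summable_mul_of_summable_norm' (hf.norm) hf (hg.norm) hg
  have := convEquiv.summable_iff.2 this
  simpa [Function.comp_def, convEquiv, norm_mul] using this

theorem summable_conv_fiber {f g : ℤ → ℂ} (hf : Summable fun n => ‖f n‖)
    (hg : Summable fun n => ‖g n‖) (n : ℤ) : Summable fun k => ‖f k * g (n - k)‖ :=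
  (summable_conv_prod hf hg).prod_factor n

theorem summable_norm_conv {f g : ℤ → ℂ} (hf : Summable fun n => ‖f n‖)
    (hg : Summable fun n => ‖g n‖) : Summable fun n => ‖conv f g n‖ :=
  Summable.of_nonneg_of_le (fun _ => norm_nonneg _)
    (fun n => norm_tsum_le_tsum_norm (summable_conv_fiber hf hg n)) (summable_conv_prod hf hg).prod

theorem tsum_norm_conv_le {f g : ℤ → ℂ} (hf : Summable fun n => ‖f n‖)
    (hg : Summable fun n => ‖g n‖) :
    ∑' n, ‖conv f g n‖ ≤ (∑' n, ‖f n‖) * ∑' n, ‖g n‖ := by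
  have h := summable_conv_prod hf hg
  calc ∑' n, ‖conv f g n‖ ≤ ∑' n, ∑' k, ‖f k * g (n - k)‖ :=
        (summable_norm_conv hf hg).tsum_le_tsum
          (fun n => norm_tsum_le_tsum_norm (summable_conv_fiber hf hg n)) h.prod
    _ = ∑' z : ℤ × ℤ, ‖f z.2 * g (z.1 - z.2)‖ := (h.tsum_prod).symm
    _ = ∑' z : ℤ × ℤ, ‖f z.1‖ * ‖g z.2‖ := by
        simp only [norm_mul]
        exact convEquiv.tsum_eq fun z : ℤ × ℤ => ‖f z.1‖ * ‖g z.2‖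
    _ = (∑' n, ‖f n‖) * ∑' n, ‖g n‖ :=
        (tsum_mul_tsum_of_summable_norm hf.norm hg.norm).symm

/-- The Fourier coefficients of a product are the convolution of the Fourier coefficients. -/
theorem series_mul_series {f g : ℤ → ℂ} (hf : Summable fun n => ‖f n‖)
    (hg : Summable fun n => ‖g n‖) : series f * series g = series (conv f g) := by
  have hf' : Summable fun n => ‖f n • (fourier n : C(Torus, ℂ))‖ := by
    simpa only [norm_smul_fourier] using hf
  have hg' : Summable fun n => ‖g n • (fourier n : C(Torus, ℂ))‖ := by
    simpa only [norm_smul_fourier] using hg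
  have key : ∀ n k : ℤ, (f k • (fourier k : C(Torus, ℂ))) * (g (n - k) • fourier (n - k))
      = (f k * g (n - k)) • (fourier n : C(Torus, ℂ)) := by
    intro n k
    ext x
    have : (fourier n x : ℂ) = fourier k x * fourier (n - k) x := by
      rw [← fourier_add]; congr 2; ring
    simp only [ContinuousMap.mul_apply, ContinuousMap.smul_apply, smul_eq_mul, this]
    ring
  have hs : Summable fun z : ℤ × ℤ => (f z.2 * g (z.1 - z.2)) • (fourier z.1 : C(Torus, ℂ)) := by
    refine Summable.of_norm ?_
    simpa only [norm_smul_fourier] using summable_conv_prod hf hg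
  rw [series, series, tsum_mul_tsum_of_summable_norm hf' hg',
    ← convEquiv.tsum_eq fun z : ℤ × ℤ =>
      (f z.1 • (fourier z.1 : C(Torus, ℂ))) * (g z.2 • (fourier z.2 : C(Torus, ℂ)))]
  simp only [convEquiv, Equiv.coe_fn_mk, key]
  rw [hs.tsum_prod, series]
  refine tsum_congr fun n => ?_
  rw [conv]
  have hc : Summable fun k => f k * g (n - k) := (summable_conv_fiber hf hg n).of_norm
  exact hc.tsum_smul_const (fourier n : C(Torus, ℂ))

end Torus

namespace EllTwo

open Torus

theorem hasSum_inv_int_sq : HasSum (fun n : ℤ => ((n : ℝ) ^ 2)⁻¹) (π ^ 2 / 3) := by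
  have h : HasSum (fun n : ℕ => (((n : ℤ) : ℝ) ^ 2)⁻¹) (π ^ 2 / 6) := by
    simpa using hasSum_zeta_two
  have h' : HasSum (fun n : ℕ => (((-(n : ℤ) : ℤ) : ℝ) ^ 2)⁻¹) (π ^ 2 / 6) := by
    simpa using hasSum_zeta_two
  have := HasSum.of_nat_of_neg (f := fun n : ℤ => ((n : ℝ) ^ 2)⁻¹) h h'
  have e : π ^ 2 / 6 + π ^ 2 / 6 - (((0 : ℤ) : ℝ) ^ 2)⁻¹ = π ^ 2 / 3 := by simp; ring
  rwa [e] at this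

/-- The sequence `1 / n`, with the value `0` at `n = 0`. -/
def invInt : EllTwo := ⟨fun n : ℤ => (n : ℂ)⁻¹, by
  refine memℓp_gen ?_
  convert! hasSum_inv_int_sq.summable using 2 with n
  simp⟩

theorem norm_invInt_le : ‖invInt‖ ≤ 2 := by
  have h : ‖invInt‖ ^ 2 = π ^ 2 / 3 := by
    rw [norm_sq_eq_tsum, ← hasSum_inv_int_sq.tsum_eq]
    refine tsum_congr fun n => ?_
    simp [invInt]
  have : π < 3.15 := Real.pi_lt_d2
  nlinarith [Real.pi_pos, norm_nonneg invInt]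

/-- If `G` is the sequence of Fourier coefficients of the derivative, the Fourier series of `F` is
absolutely summable, by the Cauchy–Schwarz inequality against `1 / n`. -/
theorem summable_norm_and_tsum_le {F G : EllTwo} (h : ∀ n : ℤ, G n = Complex.I * n * F n) :
    (Summable fun n => ‖F n‖) ∧ ∑' n, ‖F n‖ ≤ ‖F 0‖ + 2 * ‖G‖ := by
  have hpq : (2 : ENNReal).toReal.HolderConjugate (2 : ENNReal).toReal := by
    rw [Real.holderConjugate_iff]; norm_num
  have h0 : HasSum (fun n : ℤ => if n = 0 then ‖F 0‖ else 0) ‖F 0‖ := hasSum_ite_eq 0 _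
  have h1 : Summable fun n => ‖invInt n‖ * ‖G n‖ := lp.summable_mul hpq invInt G
  have h2 : ∑' n, ‖invInt n‖ * ‖G n‖ ≤ ‖invInt‖ * ‖G‖ := lp.tsum_mul_le_mul_norm' hpq invInt G
  have hle : ∀ n, ‖F n‖ ≤ (if n = 0 then ‖F 0‖ else 0) + ‖invInt n‖ * ‖G n‖ := by
    intro n
    split_ifs with hn
    · rw [hn]; exact le_add_of_nonneg_right (by positivity)
    · have : (n : ℂ) ≠ 0 := by exact_mod_cast hn
      rw [h n, ← norm_mul, zero_add]
      apply le_of_eq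
      change _ = ‖(n : ℂ)⁻¹ * (Complex.I * n * F n)‖
      rw [show (n : ℂ)⁻¹ * (Complex.I * n * F n) = Complex.I * F n by field_simp, norm_mul,
        Complex.norm_I, one_mul]
  have hs := Summable.of_nonneg_of_le (fun n => norm_nonneg (F n)) hle (h0.summable.add h1)
  refine ⟨hs, (hs.tsum_le_tsum hle (h0.summable.add h1)).trans ?_⟩
  rw [h0.summable.tsum_add h1, h0.tsum_eq]
  have := mul_le_mul_of_nonneg_right norm_invInt_le (norm_nonneg G)
  linarith

theorem D_succ_apply (j : Fin 4) (v : EllTwo) (n : ℤ) :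
    D j.succ v n = Complex.I * n * D j.castSucc v n := by
  rw [D_apply_eq, D_apply_eq j.castSucc, Fin.val_succ, Fin.val_castSucc]; ring

theorem summable_norm_D (j : Fin 4) (v : EllTwo) : Summable fun n => ‖D j.castSucc v n‖ :=
  (summable_norm_and_tsum_le (D_succ_apply j v)).1

theorem summable_D_zero (v : EllTwo) : Summable fun n => ‖D 0 v n‖ := summable_norm_D 0 v

theorem summable_D_one (v : EllTwo) : Summable fun n => ‖D 1 v n‖ := summable_norm_D 1 v

/-- The Wiener norm `∑ |ûₙ|` of the function `u` encoded by `v`; it dominates the supremum norm. -/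
def wiener (v : EllTwo) : ℝ := ∑' n, ‖D 0 v n‖

theorem wiener_nonneg (v : EllTwo) : 0 ≤ wiener v := tsum_nonneg fun _ => norm_nonneg _

theorem wiener_le (v : EllTwo) : wiener v ≤ ‖D 0 v‖ + 2 * ‖D 1 v‖ :=
  (summable_norm_and_tsum_le (D_succ_apply 0 v)).2.trans
    (by gcongr; exacts [norm_apply_le _ _, le_rfl])

theorem wiener_le_norm (v : EllTwo) : wiener v ≤ 3 * ‖v‖ := by
  have := wiener_le v
  have := norm_D_le 0 v
  have := norm_D_le 1 v
  linarith

/-! ### Products in `H⁴` -/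

/-- The sequence `|vₙ|`. -/
def absv (v : EllTwo) : EllTwo :=
  ⟨fun n => (‖v n‖ : ℂ), (lp.memℓp v).mono' fun n => by simp⟩

theorem absv_apply (v : EllTwo) (n : ℤ) : absv v n = (‖v n‖ : ℂ) := rfl

theorem norm_absv (v : EllTwo) : ‖absv v‖ = ‖v‖ :=
  le_antisymm (lp.norm_mono (by norm_num) fun n => by simp [absv_apply])
    (lp.norm_mono (by norm_num) fun n => by simp [absv_apply])

/-- The reindexing of a square-summable sequence by a permutation of `ℤ`. -/
def reindex (e : ℤ ≃ ℤ) (v : EllTwo) : EllTwo :=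
  ⟨fun n => v (e n), by
    refine memℓp_gen ?_
    exact e.summable_iff.2 ((lp.memℓp v).summable two_toReal_pos)⟩

theorem norm_reindex (e : ℤ ≃ ℤ) (v : EllTwo) : ‖reindex e v‖ = ‖v‖ := by
  have : ‖reindex e v‖ ^ 2 = ‖v‖ ^ 2 := by
    rw [norm_sq_eq_tsum, norm_sq_eq_tsum]; exact e.tsum_eq fun n => ‖v n‖ ^ 2
  exact (sq_eq_sq₀ (norm_nonneg _) (norm_nonneg _)).1 this

/-- Young's inequality `ℓ¹ * ℓ² ⊆ ℓ²`: the convolution of `|g|` and `|v|` is an absolutely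
convergent series of translates of `|v|`, by Minkowski's inequality. -/
theorem exists_young (g : ℤ → ℂ) (hg : Summable fun n => ‖g n‖) (v : EllTwo) :
    ∃ y : EllTwo, ‖y‖ ≤ (∑' n, ‖g n‖) * ‖v‖ ∧
      ∀ n, HasSum (fun k => ‖g k‖ * ‖v (n - k)‖) ‖y n‖ := by
  let F : ℤ → EllTwo := fun k => (‖g k‖ : ℂ) • reindex (Equiv.subRight k) (absv v)
  have hF : ∀ k, ‖F k‖ = ‖g k‖ * ‖v‖ := fun k => by
    simp only [F]
    rw [norm_smul, norm_reindex, norm_absv]; simp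
  have hs : Summable fun k => ‖F k‖ := by
    simp only [hF]; exact hg.mul_right _
  refine ⟨∑' k, F k, ?_, fun n => ?_⟩
  · refine (norm_tsum_le_tsum_norm hs).trans (le_of_eq ?_)
    simp only [hF]; exact tsum_mul_right
  · have h1 : HasSum (fun k => F k n) ((∑' k, F k : EllTwo) n) :=
      hs.of_norm.hasSum.mapL (lp.evalCLM ℂ (fun _ : ℤ => ℂ) (p := 2) n)
    have h2 : ∀ k, F k n = ((‖g k‖ * ‖v (n - k)‖ : ℝ) : ℂ) := fun k => by
      simp only [F, lp.coeFn_smul, Pi.smul_apply, smul_eq_mul, Complex.ofReal_mul]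
      rfl
    simp only [h2] at h1
    have h3 := h1.mapL Complex.reCLM
    simp only [Complex.reCLM_apply, Complex.ofReal_re] at h3
    have h4 := h3.mapL Complex.ofRealCLM
    simp only [Complex.ofRealCLM_apply] at h4
    have h5 := h1.unique h4
    have h6 : 0 ≤ ((∑' k, F k : EllTwo) n).re := by
      rw [← h3.tsum_eq]; exact tsum_nonneg fun k => by positivity
    rw [h5, Complex.norm_real, Real.norm_of_nonneg h6]
    exact h3

theorem wt_le_add (n k : ℤ) : wt n ≤ 8 * (wt k + wt (n - k)) := by
  have h : ∀ a b : ℝ, (a + b) ^ 4 ≤ 8 * (a ^ 4 + b ^ 4) := fun a b => by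
    nlinarith [sq_nonneg (a - b), sq_nonneg (a + b), sq_nonneg (a ^ 2 - b ^ 2),
      mul_nonneg (sq_nonneg (a - b)) (sq_nonneg (a + b)), sq_nonneg ((a - b) ^ 2),
      mul_nonneg (sq_nonneg (a - b)) (sq_nonneg a), mul_nonneg (sq_nonneg (a - b)) (sq_nonneg b)]
  have := h k (n - k)
  rw [add_sub_cancel] at this
  simp only [wt]; push_cast
  linarith

/-- The weight is distributed over the two factors of a convolution, and Young's inequality
is applied to each of the two resulting terms. -/
theorem exists_norm_conv_le (v w : EllTwo) :
    ∃ y : EllTwo, ‖y‖ ≤ 8 * (wiener v * ‖w‖ + wiener w * ‖v‖) ∧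
      ∀ n, ‖(wt n : ℂ) * conv (D 0 v) (D 0 w) n‖ ≤ ‖y n‖ := by
  obtain ⟨y, hy, hy'⟩ := exists_young (D 0 v) (summable_D_zero v) w
  obtain ⟨z, hz, hz'⟩ := exists_young (D 0 w) (summable_D_zero w) v
  refine ⟨(8 : ℂ) • (absv y + absv z), ?_, fun n => ?_⟩
  · rw [norm_smul]
    have := norm_add_le (absv y) (absv z)
    rw [norm_absv, norm_absv] at this
    simp only [Complex.norm_ofNat]
    simp only [wiener]
    linarith
  · have hz2 : HasSum (fun k => ‖v k‖ * ‖D 0 w (n - k)‖) ‖z n‖ := by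
      rw [← (Equiv.subLeft n).hasSum_iff]
      convert! hz' n using 2 with k
      simp [mul_comm]
    have hn : ‖((8 : ℂ) • (absv y + absv z) : EllTwo) n‖ = 8 * (‖y n‖ + ‖z n‖) := by
      simp only [lp.coeFn_smul, lp.coeFn_add, Pi.smul_apply, Pi.add_apply, absv_apply, smul_eq_mul]
      rw [← Complex.ofReal_add, norm_mul, Complex.norm_real, Real.norm_of_nonneg (by positivity)]
      simp
    have hs := summable_conv_fiber (summable_D_zero v) (summable_D_zero w) n
    have e : ∀ (x : EllTwo) (k : ℤ), wt k * ‖D 0 x k‖ = ‖x k‖ := fun x k => by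
      conv_rhs => rw [apply_eq_wt_mul x k, norm_mul, Complex.norm_real,
        Real.norm_of_nonneg (wt_pos k).le]
    rw [hn, norm_mul, Complex.norm_real, Real.norm_of_nonneg (wt_pos n).le]
    calc wt n * ‖conv (D 0 v) (D 0 w) n‖ ≤ wt n * ∑' k, ‖D 0 v k * D 0 w (n - k)‖ :=
          mul_le_mul_of_nonneg_left (norm_tsum_le_tsum_norm hs) (wt_pos n).le
      _ = ∑' k, wt n * ‖D 0 v k * D 0 w (n - k)‖ := tsum_mul_left.symm
      _ ≤ ∑' k, 8 * (‖D 0 v k‖ * ‖w (n - k)‖ + ‖v k‖ * ‖D 0 w (n - k)‖) := by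
          refine (hs.mul_left _).tsum_le_tsum (fun k => ?_)
            (((hy' n).summable.add hz2.summable).mul_left _)
          rw [norm_mul, ← e v k, ← e w (n - k)]
          have := mul_le_mul_of_nonneg_right (wt_le_add n k)
            (mul_nonneg (norm_nonneg (D 0 v k)) (norm_nonneg (D 0 w (n - k))))
          linarith
      _ = 8 * (‖y n‖ + ‖z n‖) := (((hy' n).add hz2).mul_left 8).tsum_eq

/-- The product of two functions in `H⁴`, in terms of the sequences that encode them. -/
def prod (v w : EllTwo) : EllTwo :=
  ⟨fun n => wt n * conv (D 0 v) (D 0 w) n, by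
    obtain ⟨y, _, hy⟩ := exists_norm_conv_le v w
    exact (lp.memℓp y).mono' hy⟩

theorem prod_apply (v w : EllTwo) (n : ℤ) : prod v w n = wt n * conv (D 0 v) (D 0 w) n := rfl

/-- The tame estimate `‖uv‖_{H⁴} ≲ ‖u‖_A ‖v‖_{H⁴} + ‖v‖_A ‖u‖_{H⁴}` with the Wiener norm `‖·‖_A`. -/
theorem norm_prod_le (v w : EllTwo) : ‖prod v w‖ ≤ 8 * (wiener v * ‖w‖ + wiener w * ‖v‖) := by
  obtain ⟨y, h, hy⟩ := exists_norm_conv_le v w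
  exact (lp.norm_mono (by norm_num) hy).trans h

theorem norm_prod_le_mul (v w : EllTwo) : ‖prod v w‖ ≤ 48 * ‖v‖ * ‖w‖ := by
  have h1 := mul_le_mul_of_nonneg_right (wiener_le_norm v) (norm_nonneg w)
  have h2 := mul_le_mul_of_nonneg_right (wiener_le_norm w) (norm_nonneg v)
  have := norm_prod_le v w
  linarith

theorem D_zero_prod (v w : EllTwo) (n : ℤ) : D 0 (prod v w) n = conv (D 0 v) (D 0 w) n := by
  rw [D_apply, symb_zero, prod_apply, inv_mul_cancel_left₀ (wt_ne_zero n)]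

theorem wiener_prod_le (v w : EllTwo) : wiener (prod v w) ≤ wiener v * wiener w := by
  simp only [wiener, D_zero_prod]
  exact tsum_norm_conv_le (summable_D_zero v) (summable_D_zero w)

theorem conv_add_left (v v' w : EllTwo) (n : ℤ) :
    conv (D 0 (v + v')) (D 0 w) n = conv (D 0 v) (D 0 w) n + conv (D 0 v') (D 0 w) n := by
  rw [conv, conv, conv,
    ← (summable_conv_fiber (summable_D_zero v) (summable_D_zero w) n).of_norm.tsum_add
    (summable_conv_fiber (summable_D_zero v') (summable_D_zero w) n).of_norm]
  refine tsum_congr fun k => ?_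
  rw [map_add, lp.coeFn_add, Pi.add_apply, add_mul]

theorem conv_add_right (v w w' : EllTwo) (n : ℤ) :
    conv (D 0 v) (D 0 (w + w')) n = conv (D 0 v) (D 0 w) n + conv (D 0 v) (D 0 w') n := by
  rw [conv, conv, conv,
    ← (summable_conv_fiber (summable_D_zero v) (summable_D_zero w) n).of_norm.tsum_add
    (summable_conv_fiber (summable_D_zero v) (summable_D_zero w') n).of_norm]
  refine tsum_congr fun k => ?_
  rw [map_add, lp.coeFn_add, Pi.add_apply, mul_add]

theorem prod_add_left (v v' w : EllTwo) : prod (v + v') w = prod v w + prod v' w := by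
  ext n
  rw [lp.coeFn_add, Pi.add_apply, prod_apply, prod_apply, prod_apply, conv_add_left, mul_add]

theorem prod_add_right (v w w' : EllTwo) : prod v (w + w') = prod v w + prod v w' := by
  ext n
  rw [lp.coeFn_add, Pi.add_apply, prod_apply, prod_apply, prod_apply, conv_add_right, mul_add]

theorem prod_sub_left (v v' w : EllTwo) : prod (v - v') w = prod v w - prod v' w := by
  rw [eq_sub_iff_add_eq, ← prod_add_left, sub_add_cancel]

theorem prod_sub_right (v w w' : EllTwo) : prod v (w - w') = prod v w - prod v w' := by
  rw [eq_sub_iff_add_eq, ← prod_add_right, sub_add_cancel]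

/-- Complex conjugation of functions, in terms of the sequences that encode them. -/
def conj (v : EllTwo) : EllTwo := star (reindex (Equiv.neg ℤ) v)

theorem conj_apply (v : EllTwo) (n : ℤ) : conj v n = star (v (-n)) := rfl

theorem norm_conj (v : EllTwo) : ‖conj v‖ = ‖v‖ := by
  rw [conj, norm_star, norm_reindex]

theorem wt_neg (n : ℤ) : wt (-n) = wt n := by
  simp [wt, Even.neg_pow (by decide : Even 4)]

theorem D_zero_conj (v : EllTwo) (n : ℤ) : D 0 (conj v) n = star (D 0 v (-n)) := by
  rw [D_apply, D_apply, conj_apply, star_mul', symb_zero, symb_zero, wt_neg]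
  simp

theorem wiener_conj (v : EllTwo) : wiener (conj v) = wiener v := by
  simp only [wiener, D_zero_conj, norm_star]
  exact (Equiv.neg ℤ).tsum_eq fun n => ‖D 0 v n‖

theorem conj_sub (v w : EllTwo) : conj (v - w) = conj v - conj w := by
  ext n
  simp [conj_apply]

/-- The cubic nonlinearity `|u|²u` in terms of the sequence that encodes `u`. -/
def cube (v : EllTwo) : EllTwo := prod (prod v (conj v)) v

theorem norm_cube_le (v : EllTwo) : ‖cube v‖ ≤ 136 * wiener v ^ 2 * ‖v‖ := by
  have h1 := norm_prod_le (prod v (conj v)) v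
  have h2 := norm_prod_le v (conj v)
  have h3 := wiener_prod_le v (conj v)
  rw [wiener_conj] at h2 h3
  rw [norm_conj] at h2
  have h4 := mul_le_mul_of_nonneg_right h3 (norm_nonneg v)
  have h5 := mul_le_mul_of_nonneg_left h2 (wiener_nonneg v)
  rw [cube]
  nlinarith

theorem norm_cube_sub_le {R : ℝ} {v w : EllTwo} (hv : ‖v‖ ≤ R) (hw : ‖w‖ ≤ R) :
    ‖cube v - cube w‖ ≤ 6912 * R ^ 2 * ‖v - w‖ := by
  have hR : 0 ≤ R := (norm_nonneg v).trans hv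
  have e : cube v - cube w = prod (prod v (conj v)) (v - w)
      + (prod (prod v (conj (v - w))) w + prod (prod (v - w) (conj w)) w) := by
    simp only [cube, conj_sub, prod_sub_left, prod_sub_right]; abel
  -- two products, each with the constant `48`
  have key : ∀ a b c : EllTwo, ∀ A B C : ℝ, ‖a‖ ≤ A → ‖b‖ ≤ B → ‖c‖ ≤ C →
      ‖prod (prod a b) c‖ ≤ 2304 * (A * B * C) := by
    intro a b c A B C ha hb hc
    have hA := (norm_nonneg a).trans ha
    have hB := (norm_nonneg b).trans hb
    calc ‖prod (prod a b) c‖ ≤ 48 * ‖prod a b‖ * ‖c‖ := norm_prod_le_mul _ _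
      _ ≤ 48 * (48 * ‖a‖ * ‖b‖) * ‖c‖ := by gcongr; exact norm_prod_le_mul _ _
      _ ≤ 48 * (48 * A * B) * C := by gcongr
      _ = 2304 * (A * B * C) := by ring
  rw [e]
  refine (norm_add_le _ _).trans ?_
  have h0 := norm_add_le (prod (prod v (conj (v - w))) w) (prod (prod (v - w) (conj w)) w)
  have h1 := key v (conj v) (v - w) R R ‖v - w‖ hv ((norm_conj v).trans_le hv) le_rfl
  have h2 := key v (conj (v - w)) w R ‖v - w‖ R hv (norm_conj _).le hw
  have h3 := key (v - w) (conj w) w ‖v - w‖ R R le_rfl ((norm_conj w).trans_le hw) hw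
  linarith

/-! ### Pointwise representatives -/

/-- The function `u` encoded by `v`, as a continuous function. -/
def rep (v : EllTwo) : C(Torus, ℂ) := series (D 0 v)

/-- The derivative `∂ₓu` of the function `u` encoded by `v`, as a continuous function. -/
def repDeriv (v : EllTwo) : C(Torus, ℂ) := series (D 1 v)

theorem norm_rep_apply_le (v : EllTwo) (x : Torus) : ‖rep v x‖ ≤ wiener v :=
  ((rep v).norm_coe_le_norm x).trans (norm_series_le (summable_D_zero v))

theorem fourierL2_rep (v : EllTwo) : fourierL2 (toL2 (rep v)) = D 0 v :=
  fourierL2_toL2_series _ (summable_D_zero v)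

theorem fourierL2_repDeriv (v : EllTwo) : fourierL2 (toL2 (repDeriv v)) = D 1 v :=
  fourierL2_toL2_series _ (summable_D_one v)

theorem rep_prod (v w : EllTwo) : rep (prod v w) = rep v * rep w := by
  rw [rep, rep, rep, series_mul_series (summable_D_zero v) (summable_D_zero w)]
  congr 1
  ext n
  exact D_zero_prod v w n

theorem rep_conj (v : EllTwo) : rep (conj v) = star (rep v) := by
  rw [rep, rep, star_series (summable_D_zero v)]
  congr 1
  ext n
  exact D_zero_conj v n

theorem rep_sub (v w : EllTwo) : rep (v - w) = rep v - rep w := by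
  rw [eq_sub_iff_add_eq, rep, rep, rep, ← series_add (summable_D_zero _) (summable_D_zero _)]
  congr 1
  rw [map_sub, lp.coeFn_sub, sub_add_cancel]

theorem repDeriv_conj (v : EllTwo) : repDeriv (conj v) = star (repDeriv v) := by
  rw [repDeriv, repDeriv, star_series (summable_D_one v)]
  congr 1
  ext n
  rw [D_one_apply, D_one_apply, D_zero_conj]
  simp

/-- The Leibniz rule. -/
theorem repDeriv_prod (v w : EllTwo) :
    repDeriv (prod v w) = repDeriv v * rep w + rep v * repDeriv w := by
  rw [repDeriv, repDeriv, repDeriv, rep, rep,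
    series_mul_series (summable_D_one v) (summable_D_zero w),
    series_mul_series (summable_D_zero v) (summable_D_one w),
    ← series_add (summable_norm_conv (summable_D_one v) (summable_D_zero w))
      (summable_norm_conv (summable_D_zero v) (summable_D_one w))]
  congr 1
  ext n
  rw [D_one_apply, D_zero_prod, Pi.add_apply, conv, conv, conv, ← tsum_mul_left,
    ← (summable_conv_fiber (summable_D_one v) (summable_D_zero w) n).of_norm.tsum_add
      (summable_conv_fiber (summable_D_zero v) (summable_D_one w) n).of_norm]
  refine tsum_congr fun k => ?_
  rw [D_one_apply, D_one_apply]
  push_cast; ring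

theorem rep_cube_apply (v : EllTwo) (x : Torus) :
    rep (cube v) x = (‖rep v x‖ : ℂ) ^ 2 * rep v x := by
  rw [cube, rep_prod, rep_prod, rep_conj]
  simp [← Complex.mul_conj']

theorem repDeriv_cube_apply (v : EllTwo) (x : Torus) :
    repDeriv (cube v) x = 2 * (‖rep v x‖ : ℂ) ^ 2 * repDeriv v x
      + rep v x ^ 2 * star (repDeriv v x) := by
  rw [cube, repDeriv_prod, repDeriv_prod, rep_prod, rep_conj, repDeriv_conj]
  simp only [ContinuousMap.add_apply, ContinuousMap.mul_apply, ContinuousMap.star_apply,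
    ← Complex.mul_conj']
  simp only [RCLike.star_def]
  ring

theorem inner_D_zero (v w : EllTwo) :
    inner ℂ (D 0 v) (D 0 w) = (2 * π : ℂ)⁻¹ * ∫ x : Torus, star (rep v x) * rep w x := by
  have hpi : (2 * π : ℂ) ≠ 0 := by exact_mod_cast Real.two_pi_pos.ne'
  rw [← fourierL2_rep v, ← fourierL2_rep w, ← inner_toL2, inner_fourierL2,
    inv_mul_cancel_left₀ hpi]

theorem inner_D_one (v w : EllTwo) :
    inner ℂ (D 1 v) (D 1 w) = (2 * π : ℂ)⁻¹ * ∫ x : Torus, star (repDeriv v x) * repDeriv w x := by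
  have hpi : (2 * π : ℂ) ≠ 0 := by exact_mod_cast Real.two_pi_pos.ne'
  rw [← fourierL2_repDeriv v, ← fourierL2_repDeriv w, ← inner_toL2, inner_fourierL2,
    inv_mul_cancel_left₀ hpi]

end EllTwo

/-! ### Pointwise inequalities for the cubic nonlinearity -/

theorem norm_I_sub_ofReal (κ : ℝ) : ‖Complex.I - κ‖ = √(1 + κ ^ 2) := by
  rw [Complex.norm_eq_sqrt_sq_add_sq]
  congr 1
  simp; ring

theorem re_I_sub_mul_ofReal (κ r : ℝ) : ((Complex.I - κ) * r).re = -κ * r := by simp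

/-- The linearisation of `(i - κ)|a|²a` in the direction `p` grows at most at the rate
`α_κ |a|²`. -/
theorem re_linearized_cube_le (κ : ℝ) (a p : ℂ) :
    ((Complex.I - κ) * (star p * (2 * (‖a‖ : ℂ) ^ 2 * p + a ^ 2 * star p))).re
      ≤ alphaLLE κ * ‖a‖ ^ 2 * ‖p‖ ^ 2 := by
  have e : (Complex.I - κ) * (star p * (2 * (‖a‖ : ℂ) ^ 2 * p + a ^ 2 * star p))
      = (Complex.I - κ) * ((2 * ‖a‖ ^ 2 * ‖p‖ ^ 2 : ℝ) : ℂ)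
        + (Complex.I - κ) * (a ^ 2 * star p ^ 2) := by
    push_cast
    rw [← Complex.mul_conj' p, RCLike.star_def]; ring
  have h := Complex.re_le_norm ((Complex.I - κ) * (a ^ 2 * star p ^ 2))
  rw [norm_mul, norm_mul, norm_pow, norm_pow, norm_star, norm_I_sub_ofReal] at h
  rw [e, Complex.add_re, re_I_sub_mul_ofReal, alphaLLE]
  linarith

/-- With `s = (a + b) / 2` and `δ = a - b`, integrating the linearised inequality over the segment
from `b` to `a` gives the rate `α_κ (|s|² + |δ|² / 12)`, and
`|s|² + |δ|² / 12 ≤ (|a|² + |b|²) / 2`. -/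
theorem re_cube_sub_cube_le {κ m : ℝ} (hα : 0 ≤ alphaLLE κ) {a b : ℂ} (ha : ‖a‖ ≤ m)
    (hb : ‖b‖ ≤ m) :
    ((Complex.I - κ) * (star (a - b) * ((‖a‖ : ℂ) ^ 2 * a - (‖b‖ : ℂ) ^ 2 * b))).re
      ≤ alphaLLE κ * m ^ 2 * ‖a - b‖ ^ 2 := by
  set s : ℂ := (a + b) / 2 with hs
  set δ : ℂ := a - b with hδ
  have par : ‖s‖ ^ 2 + ‖δ‖ ^ 2 / 4 = (‖a‖ ^ 2 + ‖b‖ ^ 2) / 2 := by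
    simp only [hs, hδ, ← Complex.normSq_eq_norm_sq, Complex.normSq_apply, Complex.sub_re,
      Complex.sub_im, Complex.div_ofNat_re, Complex.div_ofNat_im, Complex.add_re, Complex.add_im]
    ring
  have e : (Complex.I - κ) * (star δ * ((‖a‖ : ℂ) ^ 2 * a - (‖b‖ : ℂ) ^ 2 * b))
      = (Complex.I - κ) * ((2 * (‖s‖ ^ 2 + ‖δ‖ ^ 2 / 12) * ‖δ‖ ^ 2 : ℝ) : ℂ)
        + (Complex.I - κ) * (s ^ 2 * star δ ^ 2 + ((‖δ‖ ^ 4 / 12 : ℝ) : ℂ)) := by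
    push_cast
    rw [show (‖δ‖ : ℂ) ^ 4 = ((‖δ‖ : ℂ) ^ 2) ^ 2 by ring, ← Complex.mul_conj' a,
      ← Complex.mul_conj' b, ← Complex.mul_conj' s, ← Complex.mul_conj' δ, RCLike.star_def, hs, hδ]
    simp only [map_sub, map_div₀, map_add, Complex.conj_ofNat]
    ring
  have h1 := Complex.re_le_norm
    ((Complex.I - κ) * (s ^ 2 * star δ ^ 2 + ((‖δ‖ ^ 4 / 12 : ℝ) : ℂ)))
  have h2 := norm_add_le (s ^ 2 * star δ ^ 2) ((‖δ‖ ^ 4 / 12 : ℝ) : ℂ)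
  rw [norm_mul, norm_pow, norm_pow, norm_star, Complex.norm_real,
    Real.norm_of_nonneg (by positivity)] at h2
  rw [norm_mul, norm_I_sub_ofReal] at h1
  have h3 := mul_le_mul_of_nonneg_left h2 (Real.sqrt_nonneg (1 + κ ^ 2))
  rw [e, Complex.add_re, re_I_sub_mul_ofReal]
  have h4 : ‖s‖ ^ 2 + ‖δ‖ ^ 2 / 12 ≤ m ^ 2 := by
    nlinarith [norm_nonneg a, norm_nonneg b, sq_nonneg ‖δ‖]
  calc _ ≤ alphaLLE κ * (‖s‖ ^ 2 + ‖δ‖ ^ 2 / 12) * ‖δ‖ ^ 2 := by rw [alphaLLE]; linarith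
    _ ≤ alphaLLE κ * m ^ 2 * ‖δ‖ ^ 2 := by gcongr

namespace EllTwo

open Torus

theorem integrable_continuousMap (p : C(Torus, ℂ)) : Integrable p (volume : Measure Torus) :=
  p.continuous.integrable_of_hasCompactSupport (HasCompactSupport.of_compactSpace p)

theorem re_mul_integral_le {z : ℂ} {c : ℝ} {p q : C(Torus, ℂ)}
    (h : ∀ x, (z * (star (p x) * q x)).re ≤ c * ‖p x‖ ^ 2) :
    (z * ((2 * π : ℂ)⁻¹ * ∫ x : Torus, star (p x) * q x)).re
      ≤ c * ((2 * π : ℂ)⁻¹ * ∫ x : Torus, star (p x) * p x).re := by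
  have e1 : z * ((2 * π : ℂ)⁻¹ * ∫ x : Torus, star (p x) * q x)
      = (((2 * π)⁻¹ : ℝ) : ℂ) * ∫ x : Torus, z * (star (p x) * q x) := by
    rw [integral_const_mul]; push_cast; ring
  have e2 : ((2 * π : ℂ)⁻¹ * ∫ x : Torus, star (p x) * p x)
      = (((2 * π)⁻¹ : ℝ) : ℂ) * ∫ x : Torus, star (p x) * p x := by push_cast; ring
  have i1 : Integrable (fun x => z * (star (p x) * q x)) (volume : Measure Torus) :=
    integrable_continuousMap (ContinuousMap.const Torus z * (star p * q))
  have i2 : Integrable (fun x => star (p x) * p x) (volume : Measure Torus) :=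
    integrable_continuousMap (star p * p)
  rw [e1, e2, Complex.re_ofReal_mul, Complex.re_ofReal_mul, mul_left_comm]
  refine mul_le_mul_of_nonneg_left ?_ (by positivity)
  have r1 : (∫ x : Torus, z * (star (p x) * q x)).re = ∫ x : Torus, (z * (star (p x) * q x)).re :=
    (integral_re i1).symm
  have r2 : (∫ x : Torus, star (p x) * p x).re = ∫ x : Torus, (star (p x) * p x).re :=
    (integral_re i2).symm
  rw [r1, r2, ← integral_const_mul]
  refine integral_mono i1.re (i2.re.const_mul c) fun x => ?_
  refine (h x).trans (le_of_eq ?_)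
  simp only [RCLike.star_def, Complex.conj_mul']
  norm_cast

/-- The real scalar multiplication used for time derivatives is the restriction of the complex
one. -/
theorem real_smul_eq (c : ℝ) (v : EllTwo) : c • v = (c : ℂ) • v := by
  ext n
  exact (Complex.coe_smul c (v n)).symm

theorem re_inner_self (v : EllTwo) : (inner ℂ v v).re = ‖v‖ ^ 2 := by
  rw [inner_self_eq_norm_sq_to_K]; norm_cast

theorem re_mul_inner_D_zero_le {z : ℂ} {c : ℝ} {v w : EllTwo}
    (h : ∀ x, (z * (star (rep v x) * rep w x)).re ≤ c * ‖rep v x‖ ^ 2) :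
    (z * inner ℂ (D 0 v) (D 0 w)).re ≤ c * ‖D 0 v‖ ^ 2 := by
  rw [← re_inner_self, inner_D_zero, inner_D_zero]
  exact re_mul_integral_le h

theorem re_mul_inner_D_one_le {z : ℂ} {c : ℝ} {v w : EllTwo}
    (h : ∀ x, (z * (star (repDeriv v x) * repDeriv w x)).re ≤ c * ‖repDeriv v x‖ ^ 2) :
    (z * inner ℂ (D 1 v) (D 1 w)).re ≤ c * ‖D 1 v‖ ^ 2 := by
  rw [← re_inner_self, inner_D_one, inner_D_one]
  exact re_mul_integral_le h

/-! ### The equation in Fourier variables, and energy inequalities -/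

/-- The right-hand side of `∂ₜa = -(1 + iζ)a + i d ∂ₓₓa + (i - κ)|a|²a + f`, in Fourier variables;
this is the Lugiato–Lefever equation multiplied by `-i`. -/
def lleRHS (d ζ f κ : ℝ) (v : EllTwo) : EllTwo :=
  (-(1 + Complex.I * ζ)) • D 0 v + (Complex.I * d) • D 2 v
    + (Complex.I - κ) • D 0 (cube v) + (f : ℂ) • one

theorem norm_one : ‖one‖ = 1 := by
  rw [one, lp.norm_single (by norm_num)]; simp

theorem D_one_one : D 1 one = 0 := by
  ext n
  rw [D_one_apply, D_zero_one, one_apply]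
  split_ifs with h <;> simp [h]

theorem re_inner_D_zero_lleRHS_le {d ζ f κ : ℝ} (hκ : 0 ≤ κ) (v : EllTwo) :
    (inner ℂ (D 0 v) (lleRHS d ζ f κ v)).re ≤ -‖D 0 v‖ ^ 2 + |f| * ‖D 0 v‖ := by
  have h1 : ((Complex.I - κ) * inner ℂ (D 0 v) (D 0 (cube v))).re ≤ 0 * ‖D 0 v‖ ^ 2 := by
    refine re_mul_inner_D_zero_le fun x => ?_
    have e : (Complex.I - κ) * (star (rep v x) * rep (cube v) x)
        = (Complex.I - κ) * ((‖rep v x‖ ^ 4 : ℝ) : ℂ) := by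
      rw [rep_cube_apply]; push_cast
      rw [show (‖rep v x‖ : ℂ) ^ 4 = (‖rep v x‖ : ℂ) ^ 2 * (‖rep v x‖ : ℂ) ^ 2 by ring]
      nth_rw 3 [← Complex.mul_conj']
      rw [RCLike.star_def]; ring
    rw [e, re_I_sub_mul_ofReal, zero_mul, neg_mul]
    exact neg_nonpos.2 (by positivity)
  have h2 : (f * inner ℂ (D 0 v) one).re ≤ |f| * ‖D 0 v‖ := by
    refine (Complex.re_le_norm _).trans ?_
    rw [norm_mul, Complex.norm_real, Real.norm_eq_abs]
    refine mul_le_mul_of_nonneg_left ((norm_inner_le_norm _ _).trans_eq ?_) (abs_nonneg _)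
    rw [norm_one, mul_one]
  have s0 : (inner ℂ (D 0 v) (D 0 v) : ℂ) = ((‖D 0 v‖ ^ 2 : ℝ) : ℂ) := by
    rw [inner_self_eq_norm_sq_to_K]; norm_cast
  have s1 : (inner ℂ (D 1 v) (D 1 v) : ℂ) = ((‖D 1 v‖ ^ 2 : ℝ) : ℂ) := by
    rw [inner_self_eq_norm_sq_to_K]; norm_cast
  rw [lleRHS, inner_add_right, inner_add_right, inner_add_right, inner_smul_right,
    inner_smul_right, inner_smul_right, inner_smul_right, inner_D_zero_D_two, s0, s1]
  simp only [Complex.add_re] at *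
  have a1 : (-(1 + Complex.I * ζ) * ((‖D 0 v‖ ^ 2 : ℝ) : ℂ)).re = -‖D 0 v‖ ^ 2 := by
    rw [Complex.re_mul_ofReal]; simp
  have a2 : (Complex.I * d * -((‖D 1 v‖ ^ 2 : ℝ) : ℂ)).re = 0 := by
    rw [← Complex.ofReal_neg, Complex.re_mul_ofReal]; simp
  rw [a1, a2]
  linarith

theorem neg_re_inner_D_two_lleRHS_le {d ζ f κ q : ℝ} (hα : 0 ≤ alphaLLE κ) {v : EllTwo}
    (hq : alphaLLE κ * wiener v ^ 2 ≤ q) :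
    -(inner ℂ (D 2 v) (lleRHS d ζ f κ v)).re ≤ (q - 1) * ‖D 1 v‖ ^ 2 := by
  have h1 : ((Complex.I - κ) * inner ℂ (D 1 v) (D 1 (cube v))).re ≤ q * ‖D 1 v‖ ^ 2 := by
    refine re_mul_inner_D_one_le fun x => ?_
    rw [repDeriv_cube_apply]
    refine (re_linearized_cube_le κ (rep v x) (repDeriv v x)).trans ?_
    refine mul_le_mul_of_nonneg_right (le_trans ?_ hq) (by positivity)
    gcongr
    exact norm_rep_apply_le v x
  have s1 : (inner ℂ (D 1 v) (D 1 v) : ℂ) = ((‖D 1 v‖ ^ 2 : ℝ) : ℂ) := by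
    rw [inner_self_eq_norm_sq_to_K]; norm_cast
  have s2 : (inner ℂ (D 2 v) (D 2 v) : ℂ) = ((‖D 2 v‖ ^ 2 : ℝ) : ℂ) := by
    rw [inner_self_eq_norm_sq_to_K]; norm_cast
  have s3 : (inner ℂ (D 2 v) one : ℂ) = 0 := by
    rw [← D_zero_one, inner_D_two_D_zero, D_one_one, inner_zero_right, neg_zero]
  rw [lleRHS, inner_add_right, inner_add_right, inner_add_right, inner_smul_right,
    inner_smul_right, inner_smul_right, inner_smul_right, inner_D_two_D_zero, inner_D_two_D_zero,
    s1, s2, s3, mul_zero, add_zero, mul_neg (Complex.I - (κ : ℂ))]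
  simp only [Complex.add_re, Complex.neg_re] at *
  have a1 : (-(1 + Complex.I * ζ) * -((‖D 1 v‖ ^ 2 : ℝ) : ℂ)).re = ‖D 1 v‖ ^ 2 := by
    rw [neg_mul_neg, Complex.re_mul_ofReal]; simp
  have a2 : (Complex.I * d * ((‖D 2 v‖ ^ 2 : ℝ) : ℂ)).re = 0 := by
    rw [Complex.re_mul_ofReal]; simp
  rw [a1, a2]
  linarith

/-- In `L²`, the flow contracts at the rate `1 - q` where `α_κ |u|² ≤ q`. -/
theorem re_inner_sub_lleRHS_sub_le {d ζ f κ m : ℝ} (hα : 0 ≤ alphaLLE κ) {v w : EllTwo}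
    (hv : wiener v ≤ m) (hw : wiener w ≤ m) :
    (inner ℂ (D 0 (v - w)) (lleRHS d ζ f κ v - lleRHS d ζ f κ w)).re
      ≤ (alphaLLE κ * m ^ 2 - 1) * ‖D 0 (v - w)‖ ^ 2 := by
  have h1 : ((Complex.I - κ) * inner ℂ (D 0 (v - w)) (D 0 (cube v - cube w))).re
      ≤ alphaLLE κ * m ^ 2 * ‖D 0 (v - w)‖ ^ 2 := by
    refine re_mul_inner_D_zero_le fun x => ?_
    rw [rep_sub, rep_sub, ContinuousMap.sub_apply, ContinuousMap.sub_apply, rep_cube_apply,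
      rep_cube_apply]
    exact re_cube_sub_cube_le hα ((norm_rep_apply_le v x).trans hv)
      ((norm_rep_apply_le w x).trans hw)
  have e : lleRHS d ζ f κ v - lleRHS d ζ f κ w = (-(1 + Complex.I * ζ)) • D 0 (v - w)
      + (Complex.I * d) • D 2 (v - w) + (Complex.I - κ) • D 0 (cube v - cube w) := by
    simp only [lleRHS, map_sub, smul_sub]; abel
  have s0 : (inner ℂ (D 0 (v - w)) (D 0 (v - w)) : ℂ) = ((‖D 0 (v - w)‖ ^ 2 : ℝ) : ℂ) := by
    rw [inner_self_eq_norm_sq_to_K]; norm_cast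
  have s1 : (inner ℂ (D 1 (v - w)) (D 1 (v - w)) : ℂ) = ((‖D 1 (v - w)‖ ^ 2 : ℝ) : ℂ) := by
    rw [inner_self_eq_norm_sq_to_K]; norm_cast
  rw [e, inner_add_right, inner_add_right, inner_smul_right,
    inner_smul_right, inner_smul_right, inner_D_zero_D_two, s0, s1]
  have a1 : (-(1 + Complex.I * ζ) * ((‖D 0 (v - w)‖ ^ 2 : ℝ) : ℂ)).re = -‖D 0 (v - w)‖ ^ 2 := by
    rw [Complex.re_mul_ofReal]; simp
  have a2 : (Complex.I * d * -((‖D 1 (v - w)‖ ^ 2 : ℝ) : ℂ)).re = 0 := by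
    rw [← Complex.ofReal_neg, Complex.re_mul_ofReal]; simp
  rw [Complex.add_re, Complex.add_re, a1, a2]
  linarith

/-- `v` encodes a solution of the Lugiato–Lefever equation on `[0, T]` which is continuous in time
with values in `H⁴` and right-differentiable in `L²`. -/
structure IsSolutionOn (d ζ f κ T : ℝ) (v : ℝ → EllTwo) : Prop where
  continuousOn : ContinuousOn v (Icc 0 T)
  hasDeriv : ∀ t ∈ Ico 0 T, HasDerivWithinAt (fun s => D 0 (v s)) (lleRHS d ζ f κ (v t)) (Ici t) t

theorem hasDerivWithinAt_norm_sq {u : ℝ → EllTwo} {u' : EllTwo} {s : Set ℝ} {t : ℝ}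
    (h : HasDerivWithinAt u u' s t) :
    HasDerivWithinAt (fun r => ‖u r‖ ^ 2) (2 * (inner ℂ (u t) u').re) s t := by
  have h1 := (h.inner ℂ h)
  have h2 := Complex.reCLM.hasFDerivAt.comp_hasDerivWithinAt t h1
  convert! h2 using 1
  · ext r; exact (re_inner_self _).symm
  · rw [Complex.reCLM_apply, Complex.add_re, ← inner_conj_symm u' (u t), Complex.conj_re]; ring

/-- If `u ∈ C([0, T]; H²)` is differentiable in `L²`, then `‖∂ₓu‖² = -⟨u, ∂ₓₓu⟩` is differentiable,
although `∂ₓu` need not be: the increment is `-Re ⟨u(s) - u(t), ∂ₓₓu(s) + ∂ₓₓu(t)⟩`. -/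
theorem hasDerivWithinAt_norm_D_one_sq {v : ℝ → EllTwo} {u' : EllTwo} {s : Set ℝ} {t : ℝ}
    (hc : ContinuousWithinAt v s t) (h : HasDerivWithinAt (fun r => D 0 (v r)) u' s t) :
    HasDerivWithinAt (fun r => ‖D 1 (v r)‖ ^ 2) (-2 * (inner ℂ (D 2 (v t)) u').re) s t := by
  have hn : ∀ r, ‖D 1 (v r)‖ ^ 2 = -(inner ℂ (D 0 (v r)) (D 2 (v r))).re := fun r => by
    rw [inner_D_zero_D_two, Complex.neg_re, neg_neg, re_inner_self]
  have key : ∀ r, ‖D 1 (v r)‖ ^ 2 - ‖D 1 (v t)‖ ^ 2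
      = -(inner ℂ (D 0 (v r) - D 0 (v t)) (D 2 (v r) + D 2 (v t))).re := fun r => by
    have : (inner ℂ (D 0 (v r)) (D 2 (v t))).re = (inner ℂ (D 0 (v t)) (D 2 (v r))).re := by
      rw [inner_D_zero_D_two, inner_D_zero_D_two, ← inner_conj_symm, Complex.neg_re,
        Complex.conj_re, Complex.neg_re]
    rw [hn, hn, inner_sub_left, inner_add_right, inner_add_right, Complex.sub_re, Complex.add_re,
      Complex.add_re, this]
    ring
  rw [hasDerivWithinAt_iff_tendsto_slope] at h ⊢
  have hc2 : Tendsto (fun r => D 2 (v r) + D 2 (v t)) (𝓝[s \ {t}] t)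
      (𝓝 (D 2 (v t) + D 2 (v t))) :=
    (((D 2).continuous.tendsto _).comp (hc.mono sdiff_subset)).add tendsto_const_nhds
  have h3 := (Complex.continuous_re.tendsto _).comp (h.inner (𝕜 := ℂ) hc2)
  have h4 := h3.neg
  have e : -(inner ℂ u' (D 2 (v t) + D 2 (v t))).re = -2 * (inner ℂ (D 2 (v t)) u').re := by
    rw [inner_add_right, Complex.add_re, ← inner_conj_symm, Complex.conj_re]; ring
  rw [e] at h4
  refine h4.congr fun r => ?_
  simp only [Function.comp_apply, slope_def_module, key]
  rw [real_smul_eq, inner_smul_left, Complex.conj_ofReal, Complex.re_ofReal_mul, smul_eq_mul,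
    mul_neg]

theorem le_gronwallBound {g g' : ℝ → ℝ} {K ε T : ℝ} (hc : ContinuousOn g (Icc 0 T))
    (hd : ∀ t ∈ Ico 0 T, HasDerivWithinAt g (g' t) (Ici t) t)
    (hb : ∀ t ∈ Ico 0 T, g' t ≤ K * g t + ε) {t : ℝ} (ht : t ∈ Icc 0 T) :
    g t ≤ gronwallBound (g 0) K ε t := by
  have := le_gronwallBound_of_liminf_deriv_right_le hc
    (fun x hx r hr => (hd x hx).liminf_right_slope_le hr) le_rfl hb t ht
  rwa [sub_zero] at this

/-- A continuity argument: a bound which improves itself as long as it holds, holds throughout. -/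
theorem lt_of_bootstrap {g : ℝ → ℝ} {R T : ℝ} (hc : ContinuousOn g (Icc 0 T)) (h0 : g 0 < R)
    (h : ∀ τ ∈ Icc 0 T, (∀ s ∈ Icc 0 τ, g s ≤ R) → g τ < R) {t : ℝ} (ht : t ∈ Icc 0 T) :
    g t < R := by
  by_contra! hR
  have hcl : IsClosed (Icc 0 T ∩ g ⁻¹' Ici R) :=
    hc.preimage_isClosed_of_isClosed isClosed_Icc isClosed_Ici
  have hK : IsCompact (Icc 0 T ∩ g ⁻¹' Ici R) :=
    isCompact_Icc.of_isClosed_subset hcl inter_subset_left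
  obtain ⟨τ, ⟨hτ, hgτ⟩, hmin⟩ := hK.exists_isLeast ⟨t, ht, hR⟩
  refine absurd (h τ hτ fun s hs => ?_) (not_lt.2 hgτ)
  by_contra! hs'
  -- the value `R` is attained before `s`, hence at a point of the set which precedes `τ`
  obtain ⟨r, hr, hgr⟩ := intermediate_value_Ico hs.1
    (hc.mono (Icc_subset_Icc_right (hs.2.trans hτ.2))) (⟨h0.le, hs'⟩ : R ∈ Ico (g 0) (g s))
  exact absurd (hmin ⟨⟨hr.1, hr.2.le.trans (hs.2.trans hτ.2)⟩, hgr.ge⟩)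
    (not_le.2 (hr.2.trans_le hs.2))

namespace IsSolutionOn

variable {d ζ f κ T : ℝ} {v w : ℝ → EllTwo}

theorem mono (hv : IsSolutionOn d ζ f κ T v) {T' : ℝ} (h : T' ≤ T) : IsSolutionOn d ζ f κ T' v :=
  ⟨hv.continuousOn.mono (Icc_subset_Icc_right h),
    fun t ht => hv.hasDeriv t ⟨ht.1, ht.2.trans_le h⟩⟩

theorem continuousOn_norm_D_sq (hv : IsSolutionOn d ζ f κ T v) (j : Fin 5) :
    ContinuousOn (fun t => ‖D j (v t)‖ ^ 2) (Icc 0 T) :=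
  (((D j).continuous.comp_continuousOn hv.continuousOn).norm).pow 2

/-- The damping keeps the `L²` norm below the larger of its initial value and the forcing. -/
theorem norm_D_zero_le (hκ : 0 ≤ κ) (hv : IsSolutionOn d ζ f κ T v) {t : ℝ} (ht : t ∈ Icc 0 T) :
    ‖D 0 (v t)‖ ≤ max |f| ‖D 0 (v 0)‖ := by
  set M := max |f| ‖D 0 (v 0)‖ with hM
  have hM0 : 0 ≤ M := (abs_nonneg f).trans (le_max_left _ _)
  have hM1 : |f| ^ 2 ≤ M ^ 2 := by gcongr; exact le_max_left _ _
  have hM2 : ‖D 0 (v 0)‖ ^ 2 ≤ M ^ 2 := by gcongr; exact le_max_right _ _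
  have h := le_gronwallBound (K := -1) (ε := M ^ 2) (hv.continuousOn_norm_D_sq 0)
    (fun t ht => hasDerivWithinAt_norm_sq (hv.hasDeriv t ht)) (fun t _ => by
      have := re_inner_D_zero_lleRHS_le (d := d) (ζ := ζ) (f := f) hκ (v t)
      nlinarith [sq_nonneg (|f| - ‖D 0 (v t)‖)]) ht
  rw [gronwallBound_of_K_ne_0 (by norm_num)] at h
  have h2 : ‖D 0 (v t)‖ ^ 2 ≤ M ^ 2 := by
    have := mul_le_mul_of_nonneg_right hM2 (Real.exp_pos (-1 * t)).le
    refine h.trans ?_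
    rw [div_neg, div_one]
    linarith
  exact (sq_le_sq₀ (norm_nonneg _) hM0).1 h2

/-- The `H¹` energy estimate: `∂ₓu` decays at the rate `1 - q`. -/
theorem norm_D_one_sq_le (hα : 0 ≤ alphaLLE κ) (hv : IsSolutionOn d ζ f κ T v) {q : ℝ}
    (hq : ∀ t ∈ Icc 0 T, alphaLLE κ * wiener (v t) ^ 2 ≤ q) {t : ℝ} (ht : t ∈ Icc 0 T) :
    ‖D 1 (v t)‖ ^ 2 ≤ ‖D 1 (v 0)‖ ^ 2 * Real.exp (2 * (q - 1) * t) := by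
  rw [← gronwallBound_ε0]
  refine le_gronwallBound (hv.continuousOn_norm_D_sq 1)
    (fun t ht => hasDerivWithinAt_norm_D_one_sq ?_ (hv.hasDeriv t ht)) (fun t ht => ?_) ht
  · exact ((hv.continuousOn t ⟨ht.1, ht.2.le⟩).mono_of_mem_nhdsWithin
      (mem_of_superset (Icc_mem_nhdsGE ht.2) (Icc_subset_Icc_left ht.1)))
  · have := neg_re_inner_D_two_lleRHS_le (d := d) (ζ := ζ) (f := f) hα (hq t ⟨ht.1, ht.2.le⟩)
    linarith

theorem norm_D_zero_sub_sq_le (hα : 0 ≤ alphaLLE κ) (hv : IsSolutionOn d ζ f κ T v)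
    (hw : IsSolutionOn d ζ f κ T w) {m : ℝ} (hvm : ∀ t ∈ Icc 0 T, wiener (v t) ≤ m)
    (hwm : ∀ t ∈ Icc 0 T, wiener (w t) ≤ m) {t : ℝ} (ht : t ∈ Icc 0 T) :
    ‖D 0 (v t - w t)‖ ^ 2
      ≤ ‖D 0 (v 0 - w 0)‖ ^ 2 * Real.exp (2 * (alphaLLE κ * m ^ 2 - 1) * t) := by
  rw [← gronwallBound_ε0]
  refine le_gronwallBound (g := fun t => ‖D 0 (v t - w t)‖ ^ 2)
    (((D 0).continuous.comp_continuousOn (hv.continuousOn.sub hw.continuousOn)).norm.pow 2)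
    (fun t ht => hasDerivWithinAt_norm_sq (u := fun t => D 0 (v t - w t))
      (u' := lleRHS d ζ f κ (v t) - lleRHS d ζ f κ (w t)) ?_) (fun t ht => ?_) ht
  · simp only [map_sub]
    exact (hv.hasDeriv t ht).sub (hw.hasDeriv t ht)
  · have := re_inner_sub_lleRHS_sub_le (d := d) (ζ := ζ) (f := f) hα (hvm t ⟨ht.1, ht.2.le⟩)
      (hwm t ⟨ht.1, ht.2.le⟩)
    linarith

/-- Uniqueness: on a compact time interval the Wiener norms of both solutions are bounded. -/
theorem eqOn (hα : 0 ≤ alphaLLE κ) (hv : IsSolutionOn d ζ f κ T v)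
    (hw : IsSolutionOn d ζ f κ T w) (h0 : v 0 = w 0) : EqOn v w (Icc 0 T) := by
  intro t ht
  obtain ⟨A, hA⟩ := isCompact_Icc.exists_bound_of_continuousOn hv.continuousOn
  obtain ⟨B, hB⟩ := isCompact_Icc.exists_bound_of_continuousOn hw.continuousOn
  have h := norm_D_zero_sub_sq_le hα hv hw (m := 3 * max A B)
    (fun t ht => (wiener_le_norm _).trans (by linarith [hA t ht, le_max_left A B]))
    (fun t ht => (wiener_le_norm _).trans (by linarith [hB t ht, le_max_right A B])) ht
  rw [h0, sub_self, map_zero, norm_zero, zero_pow two_ne_zero, zero_mul] at h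
  have h1 : ‖D 0 (v t - w t)‖ = 0 := by nlinarith [norm_nonneg (D 0 (v t - w t))]
  rw [norm_eq_zero, map_sub, sub_eq_zero] at h1
  exact D_zero_injective h1

/-- The smallness condition is preserved: while it holds, `‖∂ₓu‖` does not increase. -/
theorem wiener_le (hκ : 0 ≤ κ) (hα : 0 ≤ alphaLLE κ) (hv : IsSolutionOn d ζ f κ T v)
    {S : ℝ} (hS : alphaLLE κ * S ^ 2 ≤ 1)
    (h0 : 2 * π * ‖D 1 (v 0)‖ + max |f| ‖D 0 (v 0)‖ < S) {t : ℝ} (ht : t ∈ Icc 0 T) :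
    wiener (v t) ≤ 2 * π * ‖D 1 (v 0)‖ + max |f| ‖D 0 (v 0)‖ := by
  set M := max |f| ‖D 0 (v 0)‖ with hM
  have hM0 : 0 ≤ M := (abs_nonneg f).trans (le_max_left _ _)
  have hpi := Real.pi_gt_three
  -- while `‖D 1 (v t)‖ ≤ R`, the Wiener norm is at most `M + 2 * R ≤ S`
  set R := (S - M) / (2 * π) with hR
  have hR2 : 2 * π * R = S - M := by rw [hR]; field_simp
  have h0R : ‖D 1 (v 0)‖ < R := by
    rw [hR, lt_div_iff₀ (by positivity)]; linarith
  have hR0 : 0 ≤ R := (norm_nonneg _).trans h0R.le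
  have key : ∀ τ ∈ Icc 0 T, (∀ s ∈ Icc 0 τ, ‖D 1 (v s)‖ ≤ R) → ‖D 1 (v τ)‖ ≤ ‖D 1 (v 0)‖ := by
    intro τ hτ hs
    have h := norm_D_one_sq_le hα (hv.mono hτ.2) (q := 1) (fun s hs' => by
      have h1 := EllTwo.wiener_le (v s)
      have h2 := hv.norm_D_zero_le hκ (t := s) ⟨hs'.1, hs'.2.trans hτ.2⟩
      have h3 := hs s hs'
      refine le_trans ?_ hS
      gcongr
      · exact wiener_nonneg _
      · nlinarith) (t := τ) ⟨hτ.1, le_rfl⟩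
    rw [sub_self, mul_zero, zero_mul, Real.exp_zero, mul_one] at h
    exact (sq_le_sq₀ (norm_nonneg _) (norm_nonneg _)).1 h
  have hb : ∀ s ∈ Icc 0 T, ‖D 1 (v s)‖ ≤ R := fun s hs =>
    (lt_of_bootstrap (g := fun t => ‖D 1 (v t)‖)
      ((D 1).continuous.comp_continuousOn hv.continuousOn).norm h0R
      (fun τ hτ h => (key τ hτ h).trans_lt h0R) hs).le
  have h1 := key t ht fun s hs => hb s ⟨hs.1, hs.2.trans ht.2⟩
  have h2 := hv.norm_D_zero_le hκ ht
  have h3 := EllTwo.wiener_le (v t)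
  nlinarith [norm_nonneg (D 1 (v 0))]

end IsSolutionOn

end EllTwo

namespace EllTwo

/-! ### The free Schrödinger group -/

theorem norm_exp_mul_I (x : ℝ) : ‖Complex.exp (x * Complex.I)‖ = 1 :=
  Complex.norm_exp_ofReal_mul_I x

/-- The unitary group `e^{i t d ∂ₓₓ}`, whose symbol is `e^{-i d n² t}`. -/
def schr (d t : ℝ) : EllTwo →L[ℂ] EllTwo :=
  mult (fun n => Complex.exp ((-(d * n ^ 2 * t) : ℝ) * Complex.I)) fun _ => (norm_exp_mul_I _).le

theorem schr_apply (d t : ℝ) (v : EllTwo) (n : ℤ) :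
    schr d t v n = Complex.exp ((-(d * n ^ 2 * t) : ℝ) * Complex.I) * v n := rfl

theorem norm_schr (d t : ℝ) (v : EllTwo) : ‖schr d t v‖ = ‖v‖ := by
  refine le_antisymm (norm_mult_le _ _ _) (lp.norm_mono (by norm_num) fun n => ?_)
  rw [schr_apply, norm_mul, norm_exp_mul_I, one_mul]

theorem schr_schr_neg (d t : ℝ) (v : EllTwo) : schr d t (schr d (-t) v) = v := by
  ext n
  rw [schr_apply, schr_apply, ← mul_assoc, ← Complex.exp_add]
  simp

theorem schr_zero (d : ℝ) (v : EllTwo) : schr d 0 v = v := by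
  ext n
  rw [schr_apply]; simp

theorem continuous_schr_apply (d : ℝ) (v : EllTwo) : Continuous fun t => schr d t v := by
  rw [continuous_iff_continuousAt]
  intro t
  have hc : Continuous fun s => ‖schr d s v - schr d t v‖ ^ 2 := by
    simp only [norm_sq_eq_tsum]
    refine continuous_tsum (u := fun n => (2 * ‖v n‖) ^ 2) (fun n => ?_) ?_ fun n s => ?_
    · simp only [lp.coeFn_sub, Pi.sub_apply, schr_apply]
      fun_prop
    · simp only [mul_pow]
      exact (summable_norm_sq v).mul_left _
    · rw [Real.norm_of_nonneg (by positivity)]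
      gcongr
      rw [lp.coeFn_sub, Pi.sub_apply]
      refine (norm_sub_le _ _).trans (le_of_eq ?_)
      rw [schr_apply, schr_apply, norm_mul, norm_mul, norm_exp_mul_I, norm_exp_mul_I]; ring
  have h := (hc.tendsto t).sqrt
  simp only [sub_self, norm_zero, ne_eq, OfNat.ofNat_ne_zero, not_false_eq_true, zero_pow,
    Real.sqrt_zero, norm_nonneg, Real.sqrt_sq] at h
  exact tendsto_iff_norm_sub_tendsto_zero.2 h

theorem continuousOn_schr {d : ℝ} {b : ℝ → EllTwo} {s : Set ℝ} (hb : ContinuousOn b s) :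
    ContinuousOn (fun t => schr d t (b t)) s := by
  intro t ht
  have h1 : Tendsto (fun r => ‖b r - b t‖ + ‖schr d r (b t) - schr d t (b t)‖) (𝓝[s] t)
      (𝓝 (0 + 0)) :=
    (tendsto_iff_norm_sub_tendsto_zero.1 (hb t ht)).add
      (tendsto_iff_norm_sub_tendsto_zero.1
        ((continuous_schr_apply d (b t)).continuousAt.continuousWithinAt (s := s)))
  rw [add_zero] at h1
  refine tendsto_iff_norm_sub_tendsto_zero.2
    (squeeze_zero (fun _ => norm_nonneg _) (fun r => ?_) h1)
  refine (norm_sub_le_norm_sub_add_norm_sub _ (schr d r (b t)) _).trans_eq ?_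
  rw [← map_sub, norm_schr]

/-! ### A globally Lipschitz truncation -/

/-- The radial retraction onto the ball of radius `R`. -/
def retract (R : ℝ) (v : EllTwo) : EllTwo := ((R / max R ‖v‖ : ℝ) : ℂ) • v

theorem retract_of_le {R : ℝ} (hR : 0 < R) {v : EllTwo} (h : ‖v‖ ≤ R) : retract R v = v := by
  rw [retract, max_eq_left h, div_self hR.ne', Complex.ofReal_one, one_smul]

theorem norm_retract_le {R : ℝ} (hR : 0 < R) (v : EllTwo) : ‖retract R v‖ ≤ R := by
  have hm : 0 < max R ‖v‖ := hR.trans_le (le_max_left _ _)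
  rw [retract, norm_smul, Complex.norm_real, Real.norm_of_nonneg (by positivity),
    div_mul_eq_mul_div, div_le_iff₀ hm]
  gcongr
  exact le_max_right _ _

theorem norm_retract_sub_le {R : ℝ} (hR : 0 < R) (v w : EllTwo) :
    ‖retract R v - retract R w‖ ≤ 2 * ‖v - w‖ := by
  set a := max R ‖v‖ with ha
  set b := max R ‖w‖ with hb
  have ha0 : 0 < a := hR.trans_le (le_max_left _ _)
  have hb0 : 0 < b := hR.trans_le (le_max_left _ _)
  have e : retract R v - retract R w
      = ((R / a : ℝ) : ℂ) • (v - w) + ((R / a * ((b - a) / b) : ℝ) : ℂ) • w := by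
    have : R / b = R / a - R / a * ((b - a) / b) := by field_simp; ring
    rw [retract, retract, ← ha, ← hb, this, smul_sub, Complex.ofReal_sub, sub_smul]
    abel
  have h1 : R / a ≤ 1 := div_le_one_of_le₀ (le_max_left _ _) ha0.le
  have h2 : ‖w‖ / b ≤ 1 := div_le_one_of_le₀ (le_max_right _ _) hb0.le
  have h3 : |b - a| ≤ ‖v - w‖ := by
    refine (abs_max_sub_max_le_max R ‖w‖ R ‖v‖).trans ?_
    rw [sub_self, abs_zero, max_eq_right (abs_nonneg _), norm_sub_rev v w]
    exact abs_norm_sub_norm_le _ _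
  rw [e]
  refine (norm_add_le _ _).trans ?_
  rw [norm_smul, norm_smul, Complex.norm_real, Complex.norm_real, norm_mul, norm_div (b - a),
    Real.norm_of_nonneg (by positivity : 0 ≤ R / a), Real.norm_eq_abs, Real.norm_of_nonneg hb0.le]
  have h4 : R / a * ‖v - w‖ ≤ 1 * ‖v - w‖ := by gcongr
  have h5 : R / a * (|b - a| / b) * ‖w‖ ≤ 1 * ‖v - w‖ := by
    calc R / a * (|b - a| / b) * ‖w‖ = R / a * (|b - a| * (‖w‖ / b)) := by ring
      _ ≤ 1 * (‖v - w‖ * 1) := by gcongr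
      _ = 1 * ‖v - w‖ := by ring
  linarith

/-- The part of the equation that is not the Schrödinger operator, acting on `H⁴`. -/
def reaction (ζ f κ : ℝ) (v : EllTwo) : EllTwo :=
  (-(1 + Complex.I * ζ)) • v + (Complex.I - κ) • cube v + (f : ℂ) • one

theorem lleRHS_eq (d ζ f κ : ℝ) (v : EllTwo) :
    lleRHS d ζ f κ v = D 0 (reaction ζ f κ v) + (Complex.I * d) • D 2 v := by
  rw [lleRHS, reaction, map_add, map_add, map_smul, map_smul, map_smul, D_zero_one]
  abel

theorem norm_reaction_le (ζ f κ : ℝ) (v : EllTwo) :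
    ‖reaction ζ f κ v‖
      ≤ (‖1 + Complex.I * ζ‖ + √(1 + κ ^ 2) * (136 * wiener v ^ 2)) * ‖v‖ + |f| := by
  rw [reaction]
  refine (norm_add₃_le).trans ?_
  rw [norm_smul, norm_smul, norm_smul, norm_neg, norm_I_sub_ofReal, norm_one, mul_one,
    Complex.norm_real, Real.norm_eq_abs]
  have := mul_le_mul_of_nonneg_left (norm_cube_le v) (Real.sqrt_nonneg (1 + κ ^ 2))
  linarith

theorem norm_reaction_sub_le (ζ f κ : ℝ) {R : ℝ} {v w : EllTwo} (hv : ‖v‖ ≤ R) (hw : ‖w‖ ≤ R) :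
    ‖reaction ζ f κ v - reaction ζ f κ w‖
      ≤ (‖1 + Complex.I * ζ‖ + √(1 + κ ^ 2) * (6912 * R ^ 2)) * ‖v - w‖ := by
  have e : reaction ζ f κ v - reaction ζ f κ w
      = (-(1 + Complex.I * ζ)) • (v - w) + (Complex.I - κ) • (cube v - cube w) := by
    simp only [reaction, smul_sub]; abel
  rw [e]
  refine (norm_add_le _ _).trans ?_
  rw [norm_smul, norm_smul, norm_neg, norm_I_sub_ofReal]
  have := mul_le_mul_of_nonneg_left (norm_cube_sub_le hv hw) (Real.sqrt_nonneg (1 + κ ^ 2))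
  linarith

theorem lipschitzWith_reaction_retract (ζ f κ : ℝ) {R : ℝ} (hR : 0 < R) :
    LipschitzWith (Real.toNNReal ((‖1 + Complex.I * ζ‖ + √(1 + κ ^ 2) * (6912 * R ^ 2)) * 2))
      fun v => reaction ζ f κ (retract R v) := by
  refine LipschitzWith.of_dist_le_mul fun v w => ?_
  rw [Real.coe_toNNReal _ (by positivity), dist_eq_norm, dist_eq_norm, mul_assoc]
  refine (norm_reaction_sub_le ζ f κ (norm_retract_le hR _) (norm_retract_le hR _)).trans ?_
  exact mul_le_mul_of_nonneg_left (norm_retract_sub_le hR _ _) (by positivity)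

/-! ### Existence on bounded time intervals -/

/-- A continuous curve in `ℓ²` is differentiable as soon as its coordinates are, provided the
derivatives are the coordinates of a continuous curve in `ℓ²`. -/
theorem hasDerivAt_of_coord {u g : ℝ → EllTwo} {a b : ℝ} (hu : ContinuousOn u (Icc a b))
    (hg : ContinuousOn g (Icc a b))
    (h : ∀ n, ∀ t ∈ Ioo a b, HasDerivAt (fun s => u s n) (g t n) t) {t : ℝ} (ht : t ∈ Ioo a b) :
    HasDerivAt u (g t) t := by
  let ev : ℤ → EllTwo →L[ℝ] ℂ := fun n => lp.evalCLM ℝ (fun _ : ℤ => ℂ) (p := 2) n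
  have key : ∀ s ∈ Icc a b, u s = u a + ∫ r in a..s, g r := by
    intro s hs
    have hsub : Icc a s ⊆ Icc a b := Icc_subset_Icc_right hs.2
    have hi : IntervalIntegrable g volume a s :=
      (hg.mono hsub).intervalIntegrable_of_Icc hs.1
    ext n
    have h1 : ∫ r in a..s, g r n = u s n - u a n :=
      intervalIntegral.integral_eq_sub_of_hasDerivAt_of_le hs.1
        ((ev n).continuous.comp_continuousOn (hu.mono hsub))
        (fun r hr => h n r ⟨hr.1, hr.2.trans_le hs.2⟩)
        (((ev n).continuous.comp_continuousOn (hg.mono hsub)).intervalIntegrable_of_Icc hs.1)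
    have h2 : ∫ r in a..s, g r n = (∫ r in a..s, g r) n :=
      (ev n).intervalIntegral_comp_comm hi
    rw [lp.coeFn_add, Pi.add_apply, ← h2, h1]; ring
  have hga : ContinuousAt g t := hg.continuousAt (Icc_mem_nhds ht.1 ht.2)
  have h3 : HasDerivAt (fun s => u a + ∫ r in a..s, g r) (g t) t :=
    (intervalIntegral.integral_hasDerivAt_right
      ((hg.mono (Icc_subset_Icc_right ht.2.le)).intervalIntegrable_of_Icc ht.1.le)
      ((hg.mono Ioo_subset_Icc_self).stronglyMeasurableAtFilter isOpen_Ioo t ht) hga).const_add _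
  refine h3.congr_of_eventuallyEq ?_
  filter_upwards [Ioo_mem_nhds ht.1 ht.2] with s hs using key s (Ioo_subset_Icc_self hs)

/-- Existence for the truncated equation: in the interaction picture `b(t) = e^{-i t d ∂ₓₓ} v(t)` it
is an ordinary differential equation in `H⁴` with a bounded, globally Lipschitz right-hand side. The
interval `[-1, T + 1]` contains `[0, T]` in its interior, so that derivatives are two-sided there. -/
theorem exists_truncated (d ζ f κ : ℝ) {R T : ℝ} (hR : 0 < R) (hT : 0 ≤ T) (v₀ : EllTwo) :
    ∃ b : ℝ → EllTwo, b 0 = v₀ ∧ ∀ t ∈ Icc (-1) (T + 1), HasDerivWithinAt b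
      (schr d (-t) (reaction ζ f κ (retract R (schr d t (b t))))) (Icc (-1) (T + 1)) t := by
  set K : ℝ := ‖1 + Complex.I * ζ‖ + √(1 + κ ^ 2) * (6912 * R ^ 2) with hK
  have hK0 : 0 ≤ K := by positivity
  set L : ℝ := (‖1 + Complex.I * ζ‖ + √(1 + κ ^ 2) * (136 * (3 * R) ^ 2)) * R + |f| with hL
  have hL0 : 0 ≤ L := by positivity
  have hp : IsPicardLindelof
      (fun t x => schr d (-t) (reaction ζ f κ (retract R (schr d t x))))
      (tmin := -1) (tmax := T + 1) ⟨0, by norm_num, by linarith⟩ v₀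
      (Real.toNNReal (L * (T + 1))) 0 (Real.toNNReal L) (Real.toNNReal (K * 2)) := by
    refine ⟨fun t _ => ?_, fun x _ => ?_, fun t _ x _ => ?_, ?_⟩
    · refine (LipschitzWith.of_dist_le_mul fun x y => ?_).lipschitzOnWith
      rw [dist_eq_norm, ← map_sub, norm_schr, ← dist_eq_norm]
      refine ((lipschitzWith_reaction_retract ζ f κ hR).dist_le_mul _ _).trans_eq ?_
      rw [dist_eq_norm, ← map_sub, norm_schr, dist_eq_norm]
    · have h3 := (lipschitzWith_reaction_retract ζ f κ hR).continuous.comp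
        (continuous_schr_apply d x)
      have h4 := (continuousOn_schr (d := -d) (h3.continuousOn (s := Icc (-1) (T + 1))))
      refine h4.congr fun t _ => ?_
      ext n
      simp only [schr_apply, Function.comp_apply]
      congr 4
      ring
    · rw [Real.coe_toNNReal _ hL0, norm_schr]
      refine (norm_reaction_le ζ f κ _).trans ?_
      have h1 := norm_retract_le hR (schr d t x)
      have h2 : wiener (retract R (schr d t x)) ≤ 3 * R := (wiener_le_norm _).trans (by linarith)
      have h3 := wiener_nonneg (retract R (schr d t x))
      rw [hL]
      gcongr
    · rw [Real.coe_toNNReal _ hL0, Real.coe_toNNReal _ (by positivity)]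
      simp only [NNReal.coe_zero, sub_zero, zero_sub, neg_neg]
      rw [max_eq_left (by linarith)]
  obtain ⟨b, hb0, hb⟩ := hp.exists_eq_forall_mem_Icc_hasDerivWithinAt₀
  exact ⟨b, hb0, hb⟩

/-- Return from the interaction picture: for `b' = e^{-i t d ∂ₓₓ} g` in `H⁴`, the curve
`e^{i t d ∂ₓₓ} b` has the derivative `g + i d ∂ₓₓ (e^{i t d ∂ₓₓ} b)` in `L²`. -/
theorem hasDerivAt_D_zero_schr {d a b' : ℝ} {b g : ℝ → EllTwo}
    (hb : ∀ t ∈ Icc a b', HasDerivWithinAt b (schr d (-t) (g t)) (Icc a b') t)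
    (hg : ContinuousOn g (Icc a b')) {t : ℝ} (ht : t ∈ Ioo a b') :
    HasDerivAt (fun s => D 0 (schr d s (b s)))
      (D 0 (g t) + (Complex.I * d) • D 2 (schr d t (b t))) t := by
  have hv : ContinuousOn (fun s => schr d s (b s)) (Icc a b') :=
    continuousOn_schr fun t ht => (hb t ht).continuousWithinAt
  refine hasDerivAt_of_coord (u := fun s => D 0 (schr d s (b s)))
    (g := fun t => D 0 (g t) + (Complex.I * d) • D 2 (schr d t (b t)))
    ((D 0).continuous.comp_continuousOn hv)
    (((D 0).continuous.comp_continuousOn hg).add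
      (ContinuousOn.const_smul (g := fun t => D 2 (schr d t (b t)))
        ((D 2).continuous.comp_continuousOn hv) (Complex.I * d))) (fun n t ht => ?_) ht
  have h1 : HasDerivAt (fun s => b s n) (schr d (-t) (g t) n) t :=
    (lp.evalCLM ℝ (fun _ : ℤ => ℂ) (p := 2) n).hasFDerivAt.comp_hasDerivAt t
      ((hb t (Ioo_subset_Icc_self ht)).hasDerivAt (Icc_mem_nhds ht.1 ht.2))
  have h2 : HasDerivAt (fun s : ℝ => Complex.exp ((-(d * n ^ 2 * s) : ℝ) * Complex.I))
      (Complex.exp ((-(d * n ^ 2 * t) : ℝ) * Complex.I) * (-(d * n ^ 2) * Complex.I)) t := by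
    have h3 : HasDerivAt (fun s : ℝ => ((-(d * n ^ 2 * s) : ℝ) : ℂ)) (-(d * n ^ 2) : ℝ) t := by
      have : HasDerivAt (fun s : ℝ => -(d * n ^ 2 * s)) (-(d * n ^ 2)) t := by
        simpa using! ((hasDerivAt_id t).const_mul (d * (n : ℝ) ^ 2)).neg
      exact this.ofReal_comp
    convert! (h3.mul_const Complex.I).cexp using 1
    push_cast; ring
  have h4 := (h2.mul h1).const_mul (symb 0 n)
  refine h4.congr_deriv ?_
  have h5 : g t n = schr d t (schr d (-t) (g t)) n := by rw [schr_schr_neg]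
  rw [lp.coeFn_add, Pi.add_apply, lp.coeFn_smul, Pi.smul_apply, D_two_apply, D_apply, D_apply, h5,
    schr_apply d t, schr_apply d t, smul_eq_mul]
  ring

/-- The truncation radius `R` exceeds the a priori bound for the `H⁴` norm on `[0, T]`: the Wiener
norm is bounded on account of the smallness condition, and then the tame estimate makes the
Grönwall inequality for the `H⁴` norm linear. -/
theorem exists_solution {d ζ f κ S T : ℝ} (hκ : 0 ≤ κ) (hα : 0 ≤ alphaLLE κ)
    (hS : alphaLLE κ * S ^ 2 ≤ 1) (hT : 0 ≤ T) {v₀ : EllTwo}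
    (h0 : 2 * π * ‖D 1 v₀‖ + max |f| ‖D 0 v₀‖ < S) :
    ∃ v : ℝ → EllTwo, v 0 = v₀ ∧ ContinuousOn v (Icc 0 T) ∧
      ∀ t ∈ Icc 0 T, HasDerivAt (fun s => D 0 (v s)) (lleRHS d ζ f κ (v t)) t := by
  set m : ℝ := 2 * π * ‖D 1 v₀‖ + max |f| ‖D 0 v₀‖ with hm
  set C : ℝ := ‖1 + Complex.I * ζ‖ + √(1 + κ ^ 2) * (136 * m ^ 2) with hC
  have hC0 : 0 ≤ C := by positivity
  have hmono := gronwallBound_mono (norm_nonneg v₀) (abs_nonneg f) hC0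
  set R : ℝ := gronwallBound ‖v₀‖ C |f| T + 1 with hR
  have hR1 : ‖v₀‖ < R := by
    have := hmono hT
    rw [gronwallBound_x0] at this
    linarith
  have hR0 : 0 < R := (norm_nonneg _).trans_lt hR1
  obtain ⟨b, hb0, hb⟩ := exists_truncated d ζ f κ hR0 hT v₀
  have hbc : ContinuousOn b (Icc (-1) (T + 1)) := fun t ht => (hb t ht).continuousWithinAt
  have hvc : ContinuousOn (fun t => schr d t (b t)) (Icc (-1) (T + 1)) := continuousOn_schr hbc
  have hv0 : schr d 0 (b 0) = v₀ := by rw [schr_zero, hb0]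
  have hsub : Icc 0 T ⊆ Icc (-1) (T + 1) := Icc_subset_Icc (by norm_num) (by linarith)
  have hgc : ContinuousOn (fun t => reaction ζ f κ (retract R (schr d t (b t))))
      (Icc (-1) (T + 1)) :=
    (lipschitzWith_reaction_retract ζ f κ hR0).continuous.comp_continuousOn hvc
  have hder : ∀ t ∈ Icc 0 T, ‖schr d t (b t)‖ ≤ R →
      HasDerivAt (fun s => D 0 (schr d s (b s))) (lleRHS d ζ f κ (schr d t (b t))) t := by
    intro t ht h
    have := hasDerivAt_D_zero_schr hb hgc (t := t) ⟨by linarith [ht.1], by linarith [ht.2]⟩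
    rwa [retract_of_le hR0 h, ← lleRHS_eq] at this
  have hlt : ∀ t ∈ Icc 0 T, ‖schr d t (b t)‖ < R := fun t ht => by
    refine lt_of_bootstrap (g := fun t => ‖schr d t (b t)‖) (hvc.mono hsub).norm
      (by rw [hv0]; exact hR1) (fun τ hτ hle => ?_) ht
    have hτs : Icc 0 τ ⊆ Icc 0 T := Icc_subset_Icc_right hτ.2
    have hsol : IsSolutionOn d ζ f κ τ fun t => schr d t (b t) :=
      ⟨hvc.mono (hτs.trans hsub), fun t ht =>
        (hder t (hτs (Ico_subset_Icc_self ht)) (hle t (Ico_subset_Icc_self ht))).hasDerivWithinAt⟩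
    have hw : ∀ t ∈ Icc 0 τ, wiener (schr d t (b t)) ≤ m := fun t ht => by
      have := hsol.wiener_le hκ hα hS (by rw [hv0]; exact h0) ht
      rwa [hv0] at this
    have hg := norm_le_gronwallBound_of_norm_deriv_right_le (f := b) (δ := ‖v₀‖) (K := C)
      (ε := |f|) (a := 0) (b := τ) (hbc.mono (hτs.trans hsub))
      (fun t ht => ((hb t (hsub (hτs (Ico_subset_Icc_self ht)))).hasDerivAt
        (Icc_mem_nhds (by linarith [ht.1]) (by linarith [ht.2, hτ.2]))).hasDerivWithinAt)
      (by rw [hb0]) (fun t ht => by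
        have ht' := Ico_subset_Icc_self ht
        rw [norm_schr, retract_of_le hR0 (hle t ht')]
        refine (norm_reaction_le ζ f κ _).trans ?_
        rw [norm_schr, hC]
        have := wiener_nonneg (schr d t (b t))
        gcongr
        exact hw t ht') τ ⟨hτ.1, le_rfl⟩
    rw [sub_zero] at hg
    change ‖schr d τ (b τ)‖ < R
    rw [norm_schr]
    exact hg.trans_lt ((hmono hτ.2).trans_lt (lt_add_one _))
  exact ⟨fun t => schr d t (b t), hv0, hvc.mono hsub, fun t ht => hder t ht (hlt t ht).le⟩

end EllTwo

namespace EllTwo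

/-! ### Existence for all times -/

/-- The solutions on `[0, N + 1]` are glued by uniqueness; near `t` the solution with `N = ⌊t⌋` is
used. -/
theorem exists_global_solution {d ζ f κ S : ℝ} (hκ : 0 ≤ κ) (hα : 0 ≤ alphaLLE κ)
    (hS : alphaLLE κ * S ^ 2 ≤ 1) {v₀ : EllTwo}
    (h0 : 2 * π * ‖D 1 v₀‖ + max |f| ‖D 0 v₀‖ < S) :
    ∃ v : ℝ → EllTwo, v 0 = v₀ ∧ ContinuousOn v (Ici 0) ∧
      ∀ t, 0 ≤ t →
        HasDerivWithinAt (fun s => D 0 (v s)) (lleRHS d ζ f κ (v t)) (Ici 0) t := by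
  choose V hV0 hVc hVd using fun N : ℕ =>
    exists_solution (d := d) (ζ := ζ) (T := N + 1) hκ hα hS (by positivity) h0
  have hsol : ∀ N : ℕ, IsSolutionOn d ζ f κ (N + 1) (V N) := fun N =>
    ⟨hVc N, fun t ht => (hVd N t (Ico_subset_Icc_self ht)).hasDerivWithinAt⟩
  have heq : ∀ N : ℕ, ∀ s ∈ Icc (0 : ℝ) (N + 1), V ⌊s⌋₊ s = V N s := fun N s hs =>
    IsSolutionOn.eqOn hα ((hsol ⌊s⌋₊).mono (Nat.lt_floor_add_one s).le) ((hsol N).mono hs.2)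
      (by rw [hV0, hV0]) ⟨hs.1, le_rfl⟩
  have hnhds : ∀ t : ℝ, 0 ≤ t → Icc 0 ((⌊t⌋₊ : ℝ) + 1) ∈ 𝓝[Ici 0] t := fun t ht => by
    rw [← Ici_inter_Iic]
    exact inter_mem_nhdsWithin _ (Iic_mem_nhds (Nat.lt_floor_add_one t))
  refine ⟨fun t => V ⌊t⌋₊ t, ?_, fun t ht => ?_, fun t ht => ?_⟩
  · exact hV0 _
  · have hmem : t ∈ Icc 0 ((⌊t⌋₊ : ℝ) + 1) := ⟨ht, (Nat.lt_floor_add_one t).le⟩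
    refine ((hVc ⌊t⌋₊ t hmem).mono_of_mem_nhdsWithin (hnhds t ht)).congr_of_eventuallyEq
      ?_ rfl
    filter_upwards [hnhds t ht] with s hs using heq _ s hs
  · have hmem : t ∈ Icc 0 ((⌊t⌋₊ : ℝ) + 1) := ⟨ht, (Nat.lt_floor_add_one t).le⟩
    refine (hVd ⌊t⌋₊ t hmem).hasDerivWithinAt.congr_of_eventuallyEq ?_ rfl
    filter_upwards [hnhds t ht] with s hs
    rw [heq _ s hs]

/-! ### Convergence to a constant -/

/-- Poincaré's inequality. -/
theorem norm_D_zero_sub_mean_le (v : EllTwo) : ‖D 0 v - (D 0 v 0) • one‖ ≤ ‖D 1 v‖ := by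
  refine lp.norm_mono (by norm_num) fun n => ?_
  rw [lp.coeFn_sub, Pi.sub_apply, lp.coeFn_smul, Pi.smul_apply, one_apply, D_one_apply]
  split_ifs with hn
  · subst hn; simp
  · have : (1 : ℝ) ≤ |(n : ℝ)| := by exact_mod_cast Int.one_le_abs hn
    rw [smul_zero, sub_zero, norm_mul, norm_mul, Complex.norm_I, one_mul, Complex.norm_intCast]
    exact le_mul_of_one_le_left (norm_nonneg _) this

/-- `∂ₓu` decays exponentially. Comparing the solution with its own time translates by means of the
`L²` contraction shows that the mean of `u` is Cauchy. -/
theorem exists_tendsto {d ζ f κ S : ℝ} (hκ : 0 ≤ κ) (hα : 0 < alphaLLE κ)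
    (hS : alphaLLE κ * S ^ 2 ≤ 1) {v : ℝ → EllTwo}
    (hv : ∀ T, IsSolutionOn d ζ f κ T v)
    (h0 : 2 * π * ‖D 1 (v 0)‖ + max |f| ‖D 0 (v 0)‖ < S) :
    ∃ c : ℂ, Tendsto (fun t => D 0 (v t)) atTop (𝓝 (c • one)) ∧
      Tendsto (fun t => D 1 (v t)) atTop (𝓝 0) := by
  set M := max |f| ‖D 0 (v 0)‖ with hM
  have hM0 : 0 ≤ M := (abs_nonneg f).trans (le_max_left _ _)
  set m : ℝ := 2 * π * ‖D 1 (v 0)‖ + M with hm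
  have hm0 : 0 ≤ m := by positivity
  have hw : ∀ t, 0 ≤ t → wiener (v t) ≤ m := fun t ht =>
    (hv t).wiener_le hκ hα.le hS h0 ⟨ht, le_rfl⟩
  have hM' : ∀ t, 0 ≤ t → ‖D 0 (v t)‖ ≤ M := fun t ht => (hv t).norm_D_zero_le hκ ⟨ht, le_rfl⟩
  have hq : alphaLLE κ * m ^ 2 - 1 < 0 := by
    have : alphaLLE κ * m ^ 2 < alphaLLE κ * S ^ 2 := by gcongr
    linarith
  set r : ℝ := 2 * (alphaLLE κ * m ^ 2 - 1) with hr
  have hexp : Tendsto (fun t : ℝ => Real.exp (r * t)) atTop (𝓝 0) :=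
    Real.tendsto_exp_atBot.comp (tendsto_id.const_mul_atTop_of_neg (by linarith))
  have hD1 : Tendsto (fun t => D 1 (v t)) atTop (𝓝 0) := by
    rw [tendsto_zero_iff_norm_tendsto_zero]
    have h1 : Tendsto (fun t => ‖D 1 (v t)‖ ^ 2) atTop (𝓝 0) := by
      refine squeeze_zero' (Eventually.of_forall fun _ => by positivity) ?_
        (by simpa using hexp.const_mul (‖D 1 (v 0)‖ ^ 2))
      filter_upwards [eventually_ge_atTop 0] with t ht
      exact (hv t).norm_D_one_sq_le hα.le (q := alphaLLE κ * m ^ 2) (fun s hs => by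
        have := wiener_nonneg (v s)
        gcongr
        exact hw s hs.1) ⟨ht, le_rfl⟩
    simpa using h1.sqrt
  have hshift : ∀ t h : ℝ, 0 ≤ t → 0 ≤ h →
      ‖D 0 (v (t + h)) - D 0 (v t)‖ ^ 2 ≤ (2 * M) ^ 2 * Real.exp (r * t) := by
    intro t h ht hh
    have hs : IsSolutionOn d ζ f κ t fun s => v (s + h) := by
      refine ⟨((hv (t + h)).continuousOn).comp (by fun_prop) fun s hs =>
        ⟨by linarith [hs.1], by linarith [hs.2]⟩, fun s hs => ?_⟩
      have h1 := (hv (t + h)).hasDeriv (s + h) ⟨by linarith [hs.1], by linarith [hs.2]⟩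
      have h2 : HasDerivWithinAt (fun s : ℝ => s + h) 1 (Ici s) s :=
        (hasDerivWithinAt_id s _).add_const h
      have := h1.scomp s h2 fun x hx => add_le_add_left hx h
      rwa [one_smul] at this
    have h3 := IsSolutionOn.norm_D_zero_sub_sq_le hα.le hs (hv t) (m := m)
      (fun s hs => hw _ (by linarith [hs.1])) (fun s hs => hw _ hs.1) (t := t) ⟨ht, le_rfl⟩
    rw [map_sub, map_sub] at h3
    refine h3.trans ?_
    gcongr
    refine (norm_sub_le _ _).trans ?_
    have := hM' (0 + h) (by linarith)
    have := hM' 0 le_rfl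
    linarith
  have hcau : CauchySeq fun t => D 0 (v t) 0 := by
    refine Metric.cauchySeq_iff'.2 fun ε hε => ?_
    have h1 : Tendsto (fun t : ℝ => (2 * M) ^ 2 * Real.exp (r * t)) atTop (𝓝 0) := by
      simpa using hexp.const_mul ((2 * M) ^ 2)
    obtain ⟨N, hN, hN0⟩ :=
      ((h1.eventually (gt_mem_nhds (by positivity : 0 < ε ^ 2))).and
        (eventually_ge_atTop 0)).exists
    refine ⟨N, fun t ht => ?_⟩
    have h2 := hshift N (t - N) hN0 (by linarith)
    rw [add_sub_cancel] at h2
    have h3 := norm_apply_le (D 0 (v t) - D 0 (v N)) 0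
    rw [dist_eq_norm]
    exact h3.trans_lt ((sq_lt_sq₀ (norm_nonneg _) hε.le).1 (h2.trans_lt hN))
  obtain ⟨c, hc⟩ := cauchySeq_tendsto_of_complete hcau
  refine ⟨c, ?_, hD1⟩
  have h1 : Tendsto (fun t => D 0 (v t) - (D 0 (v t) 0) • one) atTop (𝓝 0) := by
    rw [tendsto_zero_iff_norm_tendsto_zero]
    exact squeeze_zero (fun _ => norm_nonneg _) (fun t => norm_D_zero_sub_mean_le (v t))
      (tendsto_zero_iff_norm_tendsto_zero.1 hD1)
  simpa using h1.add (hc.smul_const one)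

end EllTwo

/-! ### Transfer to `H⁴(𝕋)` -/

namespace TorusSobolev

open Torus EllTwo

theorem fourierL2_symm_one : fourierL2.symm EllTwo.one = Lp.const 2 volume (1 : ℂ) := by
  rw [ContinuousLinearEquiv.symm_apply_eq, EllTwo.one, ← fourierL2_toL2_fourier]
  congr 1
  refine Lp.ext ?_
  filter_upwards [coeFn_toL2 (fourier 0), Lp.coeFn_const (p := 2) (μ := (volume : Measure Torus))
    (c := (1 : ℂ))] with x h1 h2
  rw [h1, h2]
  simp

theorem fourierL2_symm_D_zero (v : EllTwo) :
    fourierL2.symm (EllTwo.D 0 v) = toL2 (rep v) := by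
  rw [ContinuousLinearEquiv.symm_apply_eq, fourierL2_rep]

theorem ae_lleRHS (d ζ f κ : ℝ) (u : TorusSobolev 4) :
    ∀ᵐ x : Torus, Complex.I * fourierL2.symm (lleRHS d ζ f κ (toEllTwo u)) x =
      -(Complex.I - ζ) * TorusSobolev.D 0 u x - d * TorusSobolev.D 2 u x
        - (1 + Complex.I * κ) * ‖TorusSobolev.D 0 u x‖ ^ 2 * TorusSobolev.D 0 u x
        + Complex.I * f := by
  have e0 : fourierL2.symm (EllTwo.D 0 (toEllTwo u)) = TorusSobolev.D 0 u := by
    rw [D_toEllTwo, ContinuousLinearEquiv.symm_apply_apply]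
  have e2 : fourierL2.symm (EllTwo.D 2 (toEllTwo u)) = TorusSobolev.D 2 u := by
    rw [D_toEllTwo, ContinuousLinearEquiv.symm_apply_apply]
  have e : fourierL2.symm (lleRHS d ζ f κ (toEllTwo u))
      = (-(1 + Complex.I * ζ)) • TorusSobolev.D 0 u + (Complex.I * d) • TorusSobolev.D 2 u
        + (Complex.I - κ) • toL2 (rep (cube (toEllTwo u)))
        + (f : ℂ) • Lp.const 2 volume (1 : ℂ) := by
    rw [lleRHS, map_add, map_add, map_add, map_smul, map_smul, map_smul, map_smul, e0, e2,
      fourierL2_symm_D_zero, fourierL2_symm_one]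
  have hrep : TorusSobolev.D 0 u =ᵐ[volume] rep (toEllTwo u) := by
    rw [← e0, fourierL2_symm_D_zero]
    exact coeFn_toL2 _
  rw [e]
  filter_upwards [hrep, coeFn_toL2 (rep (cube (toEllTwo u))),
    Lp.coeFn_add ((-(1 + Complex.I * ζ)) • TorusSobolev.D 0 u + (Complex.I * d) • TorusSobolev.D 2 u
      + (Complex.I - κ) • toL2 (rep (cube (toEllTwo u)))) ((f : ℂ) • Lp.const 2 volume (1 : ℂ)),
    Lp.coeFn_add ((-(1 + Complex.I * ζ)) • TorusSobolev.D 0 u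
      + (Complex.I * d) • TorusSobolev.D 2 u) ((Complex.I - κ) • toL2 (rep (cube (toEllTwo u)))),
    Lp.coeFn_add ((-(1 + Complex.I * ζ)) • TorusSobolev.D 0 u)
      ((Complex.I * d) • TorusSobolev.D 2 u),
    Lp.coeFn_smul (-(1 + Complex.I * ζ)) (TorusSobolev.D 0 u),
    Lp.coeFn_smul (Complex.I * d) (TorusSobolev.D 2 u),
    Lp.coeFn_smul (Complex.I - κ) (toL2 (rep (cube (toEllTwo u)))),
    Lp.coeFn_smul (f : ℂ) (Lp.const 2 (volume : Measure Torus) (1 : ℂ)),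
    Lp.coeFn_const (p := 2) (μ := (volume : Measure Torus)) (c := (1 : ℂ))]
    with x h1 h2 h3 h4 h5 h6 h7 h8 h9 h10
  rw [h3, Pi.add_apply, h4, Pi.add_apply, h5, Pi.add_apply, h6, h7, h8, h9, Pi.smul_apply,
    Pi.smul_apply, Pi.smul_apply, Pi.smul_apply, h10, h2, rep_cube_apply, ← h1]
  simp only [smul_eq_mul, Function.const_apply]
  linear_combination (-ζ * TorusSobolev.D 0 u x + d * TorusSobolev.D 2 u x
    + (‖TorusSobolev.D 0 u x‖ : ℂ) ^ 2 * TorusSobolev.D 0 u x) * Complex.I_sq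

/-- A solution in `H⁴(𝕋)` is a solution in Fourier variables. -/
theorem isSolutionOn_of_isLLESolution {d ζ f κ : ℝ} {a : ℝ → TorusSobolev 4}
    (ha : IsLLESolution d ζ f κ a) (T : ℝ) :
    IsSolutionOn d ζ f κ T fun t => toEllTwo (a t) := by
  refine ⟨(continuous_toEllTwo.comp_continuousOn ha.continuousOn).mono Icc_subset_Ici_self,
    fun t ht => ?_⟩
  obtain ⟨a_t, hd, he⟩ := ha.equation t ht.1
  have h1 : a_t = fourierL2.symm (lleRHS d ζ f κ (toEllTwo (a t))) := by
    refine Lp.ext ?_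
    filter_upwards [he, ae_lleRHS d ζ f κ (a t)] with x hx hx'
    exact mul_left_cancel₀ Complex.I_ne_zero (hx.trans hx'.symm)
  have h2 := ((fourierL2 : TorusL2 →L[ℂ] EllTwo).restrictScalars
    ℝ).hasFDerivAt.comp_hasDerivWithinAt t (hd.mono (Ici_subset_Ici.2 ht.1))
  rw [h1] at h2
  simp only [D_toEllTwo]
  convert! h2 using 1
  simp

theorem isLLESolution_ofEllTwo {d ζ f κ : ℝ} {v : ℝ → EllTwo} (hc : ContinuousOn v (Ici 0))
    (hd : ∀ t, 0 ≤ t →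
      HasDerivWithinAt (fun s => EllTwo.D 0 (v s)) (lleRHS d ζ f κ (v t)) (Ici 0) t) :
    IsLLESolution d ζ f κ fun t => ofEllTwo (v t) := by
  refine ⟨continuous_ofEllTwo.comp_continuousOn hc, fun t ht =>
    ⟨fourierL2.symm (lleRHS d ζ f κ (v t)), ?_, ?_⟩⟩
  · exact ((fourierL2.symm : EllTwo →L[ℂ] TorusL2).restrictScalars
      ℝ).hasFDerivAt.comp_hasDerivWithinAt t (hd t ht)
  · have := ae_lleRHS d ζ f κ (ofEllTwo (v t))
    rwa [toEllTwo_ofEllTwo] at this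

theorem norm_D_toEllTwo (j : Fin 5) (u : TorusSobolev 4) :
    ‖TorusSobolev.D j u‖ = √(2 * π) * ‖EllTwo.D j (toEllTwo u)‖ := by
  rw [D_toEllTwo, norm_eq_mul_norm_fourierL2]

theorem tendsto_incl_const {v : ℝ → EllTwo} {c : ℂ}
    (h0 : Tendsto (fun t => EllTwo.D 0 (v t)) atTop (𝓝 (c • EllTwo.one)))
    (h1 : Tendsto (fun t => EllTwo.D 1 (v t)) atTop (𝓝 0)) (h : 1 ≤ 4) :
    Tendsto (fun t => TorusSobolev.incl h (ofEllTwo (v t))) atTop (𝓝 (TorusSobolev.const c)) := by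
  have hsymm := fourierL2.symm.continuous
  rw [tendsto_subtype_rng]
  refine ((PiLp.continuous_toLp 2 (fun _ : Fin 2 => TorusL2)).tendsto _).comp
    (tendsto_pi_nhds.2 fun j => ?_)
  fin_cases j
  · have := (hsymm.tendsto _).comp h0
    rw [map_smul, fourierL2_symm_one] at this
    convert! this using 2
    change Lp.constₗ 2 (volume : Measure Torus) ℂ c = c • Lp.constₗ 2 volume ℂ (1 : ℂ)
    rw [← map_smul, smul_eq_mul, mul_one]
  · have := (hsymm.tendsto _).comp h1
    rw [map_zero] at this
    exact this

end TorusSobolev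

theorem alphaLLE_pos {κ : ℝ} (hκ₀ : 0 ≤ κ) (hκ : κ < 1 / √3) : 0 < alphaLLE κ := by
  have h3 : (0 : ℝ) < √3 := by positivity
  have h1 : κ * √3 < 1 := (lt_div_iff₀ h3).1 hκ
  have h2 : 3 * κ ^ 2 < 1 := by
    have : (κ * √3) ^ 2 < 1 := by
      rw [sq_lt_one_iff₀ (by positivity)]; exact h1
    rwa [mul_pow, Real.sq_sqrt (by norm_num), mul_comm] at this
  have : 2 * κ < √(1 + κ ^ 2) := Real.lt_sqrt_of_sq_lt (by linarith)
  rw [alphaLLE]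
  linarith

end

theorem mainTheorem9 (d ζ f κ : ℝ) (hd : d ≠ 0) (hκ₀ : 0 ≤ κ) (hκ : κ < 1 / √3)
    (φ : TorusSobolev 4)
    (hφ : 2 * π * ‖TorusSobolev.D 1 φ‖ + max (√(2 * π) * |f|) ‖TorusSobolev.D 0 φ‖ < √(2 * π / alphaLLE κ)) :
    ∃ a : ℝ → TorusSobolev 4,
      (IsLLESolution d ζ f κ a ∧ a 0 = φ) ∧
      (∀ b : ℝ → TorusSobolev 4, IsLLESolution d ζ f κ b → b 0 = φ → EqOn b a (Ici 0)) ∧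
      ∃ c : ℂ, Tendsto (fun t => TorusSobolev.incl (by norm_num : 1 ≤ 4) (a t)) atTop
        (𝓝 (TorusSobolev.const c)) := by
  have hα := alphaLLE_pos hκ₀ hκ
  have hs : 0 < √(2 * π) := Real.sqrt_pos.2 Real.two_pi_pos
  set S : ℝ := √(1 / alphaLLE κ) with hS
  have hS1 : alphaLLE κ * S ^ 2 ≤ 1 := by
    rw [hS, Real.sq_sqrt (by positivity)]; field_simp; rfl
  -- the smallness condition, divided by the factor `√(2π)` between the `L²` and `ℓ²` norms
  have h0 : 2 * π * ‖EllTwo.D 1 (TorusSobolev.toEllTwo φ)‖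
      + max |f| ‖EllTwo.D 0 (TorusSobolev.toEllTwo φ)‖ < S := by
    have e : √(2 * π / alphaLLE κ) = √(2 * π) * S := by
      rw [hS, ← Real.sqrt_mul Real.two_pi_pos.le]; congr 1; ring
    rw [e, TorusSobolev.norm_D_toEllTwo, TorusSobolev.norm_D_toEllTwo,
      ← mul_max_of_nonneg _ _ hs.le] at hφ
    refine lt_of_mul_lt_mul_left ?_ hs.le
    linarith
  obtain ⟨v, hv0, hvc, hvd⟩ := EllTwo.exists_global_solution (d := d) (ζ := ζ) hκ₀ hα.le hS1 h0
  have ha := TorusSobolev.isLLESolution_ofEllTwo hvc hvd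
  have hsol : ∀ T, EllTwo.IsSolutionOn d ζ f κ T v := fun T => by
    have := TorusSobolev.isSolutionOn_of_isLLESolution ha T
    simpa only [TorusSobolev.toEllTwo_ofEllTwo] using this
  refine ⟨fun t => TorusSobolev.ofEllTwo (v t),
    ⟨ha, by simp only [hv0, TorusSobolev.ofEllTwo_toEllTwo]⟩, ?_, ?_⟩
  · intro b hb hb0 t ht
    have h1 := EllTwo.IsSolutionOn.eqOn hα.le
      (TorusSobolev.isSolutionOn_of_isLLESolution hb t) (hsol t)
      (by rw [hb0, hv0]) (⟨ht, le_rfl⟩ : t ∈ Icc 0 t)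
    simp only at h1
    exact (TorusSobolev.ofEllTwo_toEllTwo (b t)).symm.trans (congrArg TorusSobolev.ofEllTwo h1)
  · obtain ⟨c, hc0, hc1⟩ := EllTwo.exists_tendsto hκ₀ hα hS1 hsol (by rw [hv0]; exact h0)
    exact ⟨c, TorusSobolev.tendsto_incl_const hc0 hc1 _⟩
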